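/- **Setting.** Fix $\lambda_B,\lambda_D,\rho,\sigma^2,\gamma_{th},P,P_{DL},\delta_1,\omega>0$, a path-loss exponent $\alpha>2$, integers $S_0,K_0\ge 1$, $\mu\ge 0$, $\mathcal R\in[0,1]$, and $c=3.575$. Put $$D_0=\Big(\frac{\delta_1\omega}{P_{DL}}\Big)^{-1/\alpha},\quad \lambda_0=\big(1-e^{-\lambda_B\pi D_0^2}\big)\lambda_D,\quad \lambda_0^a=\frac{\lambda_0}{S_0},\quad \mathcal A=\mathbb P[\mathrm{Pois}(\mu)>0],\quad \Lambda=\mathcal A\,\mathcal R\,\lambda_0^a .$$ Base stations (BSs) form a Poisson point process of intensity $\lambda_B$ in $\mathbb R^2$; the typical BS is at the origin. The devices of coverage-enhancement (CE) group 0 that are active in the first slot on the preamble of the typical device are modelled by a Poisson point process of intensity $\Lambda$ in $\mathbb R^2$. Its points $x_j$ carry independent marks: a serving distance $d_j$, distributed as the distance from a fixed point to the nearest BS conditioned to be at most $(P/\rho)^{1/\alpha}$, and fading gains $g_j^{k,\beta}$ that are independent $\mathrm{Exp}(1)$ variables. Device $j$ transmits with the path-loss inversion power $\rho d_j^\alpha$.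 By nearest-BS association, only devices with $d_j\le\|x_j\|$ interfere at the origin, so that in symbol group $\beta\in\{1,2,3,4\}$ of repetition $k\in\{1,\dots,K_0\}$ the interference is $$I^{k,\beta}=\sum_{j:\,d_j\le \|x_j\|}\rho\, d_j^{\alpha}\, g_j^{k,\beta}\,\|x_j\|^{-\alpha}.$$ For $m=0$ (the typical device) and $m\ge1$ (its competitors on the same preamble in the same cell) put $\mathrm{SINR}_m^{k,\beta}=\rho h_m^{k,\beta}/(I^{k,\beta}+\sigma^2)$, where the $h_m^{k,\beta}$ are independent $\mathrm{Exp}(1)$ variables, independent of the interfering process. A preamble is received if in at least one of the $K_0$ repetitions all four SINRs are at least $\gamma_{th}$; let $\mathbb P_{S,m}$ be the probability of this event for device $m$. The number $N$ of competitors is mixed Poisson: given $a$, it is Poisson with mean $\Lambda a$, where the cell area $a$ has the approximating gamma law with shape $c+1$ and rate $c\lambda_B$. The first-slot random-access (RACH) success probability of a randomly chosen group 0 device is $$\mathcal P_0^1=\mathbb E_N\Big[\mathbb P_{S,0}\prod_{m=1}^{N}\big(1-\mathbb P_{S,m}\big)\Big].$$ **Theorem.** One has $\mathcal A=1-e^{-\mu}$.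 For every $n\ge 0$, $$\mathbb P[N=n]=q(n):=\frac{c^{c+1}\,\Gamma(n+c+1)\,(\Lambda/\lambda_B)^{n}}{\Gamma(c+1)\,\Gamma(n+1)\,(\Lambda/\lambda_B+c)^{n+c+1}} .$$ For every $m\ge 0$, $$\mathbb P_{S,m}=\Theta:=\sum_{k=1}^{K_0}(-1)^{k+1}\binom{K_0}{k}\exp\!\Big(-\frac{4k\,\gamma_{th}\sigma^2}{\rho}-\frac{2\,\gamma_{th}^{2/\alpha}\,\Lambda\;\gamma\big(2,\pi\lambda_B(P/\rho)^{2/\alpha}\big)}{\lambda_B\big(1-e^{-\pi\lambda_B(P/\rho)^{2/\alpha}}\big)}\,\mathcal F_0(4k)\Big),$$ where $\gamma(a,b)=\int_0^b t^{a-1}e^{-t}\,dt$ and $\mathcal F_0(l)=\int_{\gamma_{th}^{-1/\alpha}}^\infty\Big[1-\Big(\frac1{1+y^{-\alpha}}\Big)^{l}\Big]\,y\,dy$. Finally, the series below converges and $$\mathcal P_0^1=\sum_{n_0=0}^\infty q(n_0)\,\Theta\,(1-\Theta)^{n_0}.$$ -/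

import Mathlib

open MeasureTheory ProbabilityTheory Real
open scoped ENNReal NNReal

noncomputable section

/-! ## Poisson point processes -/

/-- `Φ` is a Poisson point process with intensity measure `Λ`: a random measure whose count in
each measurable set of finite intensity is Poisson distributed with mean the intensity of the set,
and whose counts in pairwise disjoint measurable sets are independent. -/
structure IsPoissonProcess {Ω E : Type*} [MeasurableSpace Ω] [MeasurableSpace E]
    (Φ : Ω → Measure E) (Λ : Measure E) (Pr : Measure Ω) : Prop where
  measurable : Measurable Φ
  count_law : ∀ A : Set E, MeasurableSet A → Λ A < ∞ →
    Pr.map (fun ω => Φ ω A) =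
      (poissonMeasure (Λ A).toNNReal).map (fun n : ℕ => (n : ℝ≥0∞))
  indep : ∀ (n : ℕ) (A : Fin n → Set E), (∀ i, MeasurableSet (A i)) →
    Pairwise (fun i j => Disjoint (A i) (A j)) →
    iIndepFun (fun i ω => Φ ω (A i)) Pr

/-- The plane with its Euclidean norm; the typical base station sits at the origin. -/
abbrev Plane := EuclideanSpace ℝ (Fin 2)

/-- Symbol groups of a preamble sent `K` times: (repetition, one of the four symbol groups). -/
abbrev SymbolGroup (K : ℕ) := Fin K × Fin 4

/-- A potential interferer: its position, the distance to its own serving base station, and its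
fading gain towards the typical base station in every symbol group. -/
abbrev Interferer (K : ℕ) := Plane × ℝ × (SymbolGroup K → ℝ)

/-! ## Parameters -/

/-- The parameters of the network that matter for coverage-enhancement (CE) group 0. -/
structure RachParams where
  /-- intensity of the base stations -/
  lamB : ℝ
  /-- intensity of the devices -/
  lamD : ℝ
  /-- path-loss exponent -/
  alpha : ℝ
  /-- power-control threshold: the average received power of a group 0 device -/
  rho : ℝ
  /-- noise power at the base station -/
  sigma2 : ℝ
  /-- SINR threshold -/
  gammaTh : ℝ
  /-- the uplink power limit `P` -/
  pUL : ℝ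
  /-- downlink transmit power -/
  pDL : ℝ
  /-- downlink SNR threshold of group 0 -/
  delta1 : ℝ
  /-- noise power at a device -/
  omega : ℝ
  /-- number of preambles reserved for group 0 -/
  S0 : ℕ
  /-- number of repetitions of group 0 -/
  K0 : ℕ
  /-- mean number of packets that arrive at a device in the first slot -/
  muNew : ℝ≥0
  /-- probability that access is not restricted in the first slot -/
  R : ℝ

namespace RachParams

/-- The admissible ranges of the parameters. -/
structure Admissible (p : RachParams) : Prop where
  lamB_pos : 0 < p.lamB
  lamD_pos : 0 < p.lamD
  two_lt_alpha : 2 < p.alpha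
  rho_pos : 0 < p.rho
  sigma2_pos : 0 < p.sigma2
  gammaTh_pos : 0 < p.gammaTh
  pUL_pos : 0 < p.pUL
  pDL_pos : 0 < p.pDL
  delta1_pos : 0 < p.delta1
  omega_pos : 0 < p.omega
  S0_pos : 1 ≤ p.S0
  K0_pos : 1 ≤ p.K0
  R_nonneg : 0 ≤ p.R
  R_le_one : p.R ≤ 1

variable (p : RachParams)

/-- Radius of the coverage area of group 0. -/
def D0 : ℝ := (p.delta1 * p.omega / p.pDL) ^ (-(1 / p.alpha))

/-- Density of the devices of group 0. -/
def lam0 : ℝ := (1 - exp (-(p.lamB * π * p.D0 ^ 2))) * p.lamD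

/-- Density of the devices of group 0 that choose one given preamble. -/
def lam0a : ℝ := p.lam0 / p.S0

/-- Probability that the buffer of a device is non-empty in the first slot. -/
def nonEmptyProb : ℝ := (poissonMeasure p.muNew).real {n | 0 < n}

/-- Density of the devices of group 0 that are active in the first slot on one given preamble. -/
def activeDensity : ℝ := p.nonEmptyProb * p.R * p.lam0a

/-! ## The number of intra-group interferers -/

/-- The constant of the gamma approximation of the area of a Poisson-Voronoi cell. -/
def cVor : ℝ := 3.575

/-- Law of the number of competing devices in the cell of a randomly chosen device. The area of
the typical cell is approximated by the gamma law with shape `c` and rate `c * lamB`, so the area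
of the cell that contains a given device follows its size-biased version, the gamma law with shape
`c + 1` and the same rate; given the area, the count is Poisson. -/
def competitorLaw : Measure ℕ :=
  (gammaMeasure (cVor + 1) (cVor * p.lamB)).bind
    (fun a => poissonMeasure (p.activeDensity * a).toNNReal)

/-! ## Interference, SINR, success probabilities -/

/-- Distance from the origin to the nearest point of a configuration. -/
def nearestDist (φ : Measure Plane) : ℝ :=
  sInf {r : ℝ | 0 ≤ r ∧ φ (Metric.closedBall 0 r) ≠ 0}

/-- Law of the distance between a transmitting device of group 0 and its serving (nearest) base
station: the nearest-point distance of the base-station process, given that the path loss can be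
inverted with a power of at most `pUL`, that is, `rho * d ^ alpha ≤ pUL`. -/
def servingDistLaw {Ω : Type*} [MeasurableSpace Ω] (ΦB : Ω → Measure Plane) (Pr : Measure Ω) :
    Measure ℝ :=
  cond (Pr.map (fun ω => nearestDist (ΦB ω))) (Set.Iic ((p.pUL / p.rho) ^ (1 / p.alpha)))

/-- Intensity measure of the active devices on the preamble of the typical device, independently
marked with their serving distances and with unit-mean exponential fading gains. -/
def interfererIntensity {Ω : Type*} [MeasurableSpace Ω] (ΦB : Ω → Measure Plane)
    (Pr : Measure Ω) : Measure (Interferer p.K0) :=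
  ENNReal.ofReal p.activeDensity •
    (volume : Measure Plane).prod
      ((p.servingDistLaw ΦB Pr).prod (Measure.pi fun _ : SymbolGroup p.K0 => expMeasure 1))

/-- Aggregate interference at the origin in symbol group `s`: the sum over the points
`(x, d, g)` of `z` of transmit power `rho * d ^ alpha` times gain `g s` times path loss
`‖x‖ ^ (-alpha)`. As a device is served by its nearest base station, only points with
`d ≤ ‖x‖` count. -/
def interference (z : Measure (Interferer p.K0)) (s : SymbolGroup p.K0) : ℝ≥0∞ :=
  ∫⁻ y in {y : Interferer p.K0 | y.2.1 ≤ ‖y.1‖},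
    ENNReal.ofReal (p.rho * y.2.1 ^ p.alpha * y.2.2 s * ‖y.1‖ ^ (-p.alpha)) ∂z

/-- SINR in symbol group `s` of a device with average received power `rho` and gain `g`. -/
def sinr (z : Measure (Interferer p.K0)) (g : ℝ) (s : SymbolGroup p.K0) : ℝ≥0∞ :=
  ENNReal.ofReal (p.rho * g) / (p.interference z s + ENNReal.ofReal p.sigma2)

variable {Ω : Type*} [MeasurableSpace Ω] (Pr : Measure Ω)
  (Z : Ω → Measure (Interferer p.K0)) (h : ℕ → SymbolGroup p.K0 → Ω → ℝ)

/-- Event that all four symbol groups of repetition `k` of device `m` reach the threshold. -/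
def repetitionSuccess (m : ℕ) (k : Fin p.K0) : Set Ω :=
  {ω | ∀ b : Fin 4, ENNReal.ofReal p.gammaTh ≤ p.sinr (Z ω) (h m (k, b) ω) (k, b)}

/-- Preamble success probability of device `m`: at least one repetition is received. -/
def preambleSuccessProb (m : ℕ) : ℝ :=
  Pr.real (⋃ k : Fin p.K0, p.repetitionSuccess Z h m k)

/-- RACH success probability of the typical device `0`: the expectation over the number `N` of
intra-group interferers `1, ..., N` of its preamble success probability times the product of the
preamble failure probabilities of the interferers. -/
def rachSuccessProb (N : Ω → ℕ) : ℝ :=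
  ∫ ω, p.preambleSuccessProb Pr Z h 0 *
    ∏ m ∈ Finset.Icc 1 (N ω), (1 - p.preambleSuccessProb Pr Z h m) ∂Pr

/-! ## The closed form -/

/-- The lower incomplete gamma function. -/
def lowerGamma (a b : ℝ) : ℝ := ∫ t in (0 : ℝ)..b, t ^ (a - 1) * exp (-t)

/-- The integral `F₀`, for `l` symbol groups. -/
def F0 (l : ℕ) : ℝ :=
  ∫ y in Set.Ioi (p.gammaTh ^ (-1 / p.alpha)), (1 - (1 / (1 + y ^ (-p.alpha))) ^ l) * y

/-- Closed form of the probability mass function of the number of intra-group interferers. -/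
def pmfClosedForm (n : ℕ) : ℝ :=
  cVor ^ (cVor + 1) * Gamma (n + cVor + 1) * (p.activeDensity / p.lamB) ^ n /
    (Gamma (cVor + 1) * Gamma (n + 1) *
      (p.activeDensity / p.lamB + cVor) ^ ((n : ℝ) + cVor + 1))

/-- Closed form of the preamble success probability; `4 * k` is the number of symbol groups in
`k` repetitions. -/
def preambleClosedForm : ℝ :=
  ∑ k ∈ Finset.Icc 1 p.K0, (-1 : ℝ) ^ (k + 1) * (p.K0.choose k : ℝ) *
    exp (-((4 * k : ℕ) : ℝ) * p.gammaTh * p.sigma2 / p.rho -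
      2 * p.gammaTh ^ (2 / p.alpha) * p.activeDensity *
          lowerGamma 2 (π * p.lamB * (p.pUL / p.rho) ^ (2 / p.alpha)) /
        (p.lamB * (1 - exp (-(π * p.lamB * (p.pUL / p.rho) ^ (2 / p.alpha))))) *
      p.F0 (4 * k))

end RachParams

end

/-! Fix a finite set `T` of symbol groups of one device. Given the interferers `Z`, its fading gains
are independent `Exp(1)`, and the tail of `Exp(1)` is an exponential. So the probability that all
SINRs in `T` reach the threshold is `exp (-|T| γσ²/ρ)` times `exp (-∫ load dZ)`, where `load`
(`thresholdLoad`) is the contribution of one point to `(γ/ρ) ∑_{s ∈ T} I_s`. Averaging over `Z` is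
therefore the Laplace functional of a Poisson process, `exp (-∫ (1 - e^{-load}))` with respect to
the intensity (`IsPoissonProcess.lintegral_expNeg`).

The exponent is an iterated integral. Averaging over the gains turns `e^{-load}` into `(1 + γ d^α
‖x‖^{-α})^{-|T|}` on `d ≤ ‖x‖`. Polar coordinates and the scaling `‖x‖ = d γ^{1/α} y` then give `2π
γ^{2/α} d² F₀(|T|)` (`lintegral_plane_one_sub_pow`), so only the second moment of the serving
distance matters. The squared nearest distance is exponential with rate `πλ_B`, by void
probabilities, and its truncated mean is the incomplete gamma factor
(`lintegral_sq_cond_nearestDist`).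

All repetitions see the same interferers, so they are not independent. But the joint success
probability of `k` of them depends only on `|T| = 4k`, and inclusion-exclusion gives the alternating
sum `Θ`.

The competitor count is a gamma mixture of Poisson laws, hence negative binomial by conjugacy. Each
preamble success probability is the number `Θ`, so the RACH probability is the expectation of `Θ (1
- Θ)^N`, expanded over the values of `N`. -/

/-! ## The function `x ↦ exp (-x)` on the extended nonnegative reals -/

/-- `exp (-x)` for `x : ℝ≥0∞`, with value `0` at infinity. -/
noncomputable def expNeg (x : ℝ≥0∞) : ℝ≥0∞ := EReal.exp (-(x : EReal))

lemma expNeg_ofReal {r : ℝ} (hr : 0 ≤ r) :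
    expNeg (ENNReal.ofReal r) = ENNReal.ofReal (Real.exp (-r)) := by
  rw [expNeg, EReal.coe_ennreal_ofReal, max_eq_left hr, ← EReal.coe_neg, EReal.exp_coe]

lemma expNeg_zero : expNeg 0 = 1 := by simp [expNeg]

lemma expNeg_top : expNeg ⊤ = 0 := by simp [expNeg]

lemma antitone_expNeg : Antitone expNeg := fun x y h => by
  unfold expNeg
  apply EReal.exp_monotone
  rw [EReal.neg_le_neg_iff]
  exact_mod_cast h

lemma expNeg_le_one (x : ℝ≥0∞) : expNeg x ≤ 1 := by
  rw [← expNeg_zero]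
  exact antitone_expNeg zero_le

lemma expNeg_add (x y : ℝ≥0∞) : expNeg (x + y) = expNeg x * expNeg y := by
  induction x with
  | top => simp [expNeg_top]
  | coe x =>
    induction y with
    | top => simp [expNeg_top]
    | coe y =>
      rw [← ENNReal.ofReal_coe_nnreal, ← ENNReal.ofReal_coe_nnreal,
        ← ENNReal.ofReal_add x.coe_nonneg y.coe_nonneg, expNeg_ofReal x.coe_nonneg,
        expNeg_ofReal y.coe_nonneg,
        expNeg_ofReal (add_nonneg x.coe_nonneg y.coe_nonneg),
        ← ENNReal.ofReal_mul (Real.exp_nonneg _),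
        ← Real.exp_add, neg_add]

lemma expNeg_sum {ι : Type*} (s : Finset ι) (f : ι → ℝ≥0∞) :
    expNeg (∑ i ∈ s, f i) = ∏ i ∈ s, expNeg (f i) := by
  classical
  induction s using Finset.induction_on with
  | empty => simp [expNeg_zero]
  | insert a s ha ih => rw [Finset.sum_insert ha, Finset.prod_insert ha, expNeg_add, ih]

lemma continuous_expNeg : Continuous expNeg :=
  ENNReal.continuous_exp.comp (continuous_neg.comp continuous_coe_ennreal_ereal)

@[fun_prop]
lemma measurable_expNeg : Measurable expNeg := continuous_expNeg.measurable

/-! ## The Laplace functional of a Poisson process -/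

lemma lintegral_poissonMeasure (r : ℝ≥0) (f : ℕ → ℝ≥0∞) :
    ∫⁻ n, f n ∂poissonMeasure r =
      ∑' n : ℕ, ENNReal.ofReal (Real.exp (-r) * r ^ n / n.factorial) * f n := by
  rw [poissonMeasure, lintegral_sum_measure]
  simp [lintegral_smul_measure, lintegral_dirac]

/-- The Poisson generating function at `e^{-t}`, summed by the exponential series. -/
lemma lintegral_expNeg_poissonMeasure (r : ℝ≥0) {t : ℝ≥0∞} (ht : t ≠ ⊤) :
    ∫⁻ n : ℕ, expNeg (t * n) ∂poissonMeasure r = expNeg (r * (1 - expNeg t)) := by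
  lift t to ℝ≥0 using ht
  have hu : Real.exp (-(t : ℝ)) ≤ 1 := Real.exp_le_one_iff.2 (by simp)
  rw [lintegral_poissonMeasure]
  have h1 : ∀ n : ℕ, ENNReal.ofReal (Real.exp (-r) * r ^ n / n.factorial) *
      expNeg ((t : ℝ≥0∞) * n) = ENNReal.ofReal
        (Real.exp (-r) * ((r * Real.exp (-(t : ℝ))) ^ n / n.factorial)) := by
    intro n
    have : ((t : ℝ≥0∞) * n) = ENNReal.ofReal (t * n) := by
      rw [ENNReal.ofReal_mul t.coe_nonneg]; simp
    rw [this, expNeg_ofReal (by positivity), ← ENNReal.ofReal_mul (by positivity)]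
    congr 1
    rw [mul_pow, ← Real.exp_nat_mul]
    ring_nf
  simp_rw [h1]
  have hs : HasSum (fun n : ℕ => Real.exp (-r) * ((r * Real.exp (-(t : ℝ))) ^ n / n.factorial))
      (Real.exp (-r) * Real.exp (r * Real.exp (-(t : ℝ)))) := by
    have := NormedSpace.expSeries_div_hasSum_exp ((r : ℝ) * Real.exp (-(t : ℝ)))
    rw [← Real.exp_eq_exp_ℝ] at this
    exact this.mul_left _
  rw [← ENNReal.ofReal_tsum_of_nonneg (fun n => by positivity) hs.summable, hs.tsum_eq,
    ← ENNReal.ofReal_coe_nnreal (p := t), expNeg_ofReal t.coe_nonneg, ← ENNReal.ofReal_one,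
    ← ENNReal.ofReal_sub _ (Real.exp_nonneg _), ← ENNReal.ofReal_coe_nnreal (p := r),
    ← ENNReal.ofReal_mul r.coe_nonneg, expNeg_ofReal (mul_nonneg r.coe_nonneg (by linarith)),
    ← Real.exp_add]
  congr 2
  ring

namespace IsPoissonProcess

variable {Ω E : Type*} [MeasurableSpace Ω] [MeasurableSpace E] {Φ : Ω → Measure E}
  {Λ : Measure E} {Pr : Measure Ω}

lemma measurable_count (hΦ : IsPoissonProcess Φ Λ Pr) {A : Set E} (hA : MeasurableSet A) :
    Measurable fun ω => Φ ω A :=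
  (Measure.measurable_coe hA).comp hΦ.measurable

lemma lintegral_count (hΦ : IsPoissonProcess Φ Λ Pr) {A : Set E} (hA : MeasurableSet A)
    (hA' : Λ A ≠ ⊤) {f : ℝ≥0∞ → ℝ≥0∞} (hf : Measurable f) :
    ∫⁻ ω, f (Φ ω A) ∂Pr = ∫⁻ n : ℕ, f n ∂poissonMeasure (Λ A).toNNReal := by
  rw [← lintegral_map hf (hΦ.measurable_count hA), hΦ.count_law A hA hA'.lt_top,
    lintegral_map hf .of_discrete]

lemma lintegral_expNeg_count (hΦ : IsPoissonProcess Φ Λ Pr) {A : Set E} (hA : MeasurableSet A)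
    (hA' : Λ A ≠ ⊤) {t : ℝ≥0∞} (ht : t ≠ ⊤) :
    ∫⁻ ω, expNeg (t * Φ ω A) ∂Pr = expNeg (Λ A * (1 - expNeg t)) := by
  rw [hΦ.lintegral_count hA hA' (f := fun x => expNeg (t * x))
    (measurable_expNeg.comp (measurable_const_mul t)), lintegral_expNeg_poissonMeasure _ ht,
    ENNReal.coe_toNNReal hA']

/-- The fibres over the nonzero values are disjoint with finite intensity, so their counts are
independent Poisson variables and the expectation factors. The zero fibre may have infinite
intensity, but it contributes nothing to either integral. -/
lemma lintegral_expNeg_simpleFunc (hΦ : IsPoissonProcess Φ Λ Pr) (f : SimpleFunc E ℝ≥0∞)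
    (hf : ∀ x, f x ≠ ⊤) (hf' : ∀ y ≠ 0, Λ (f ⁻¹' {y}) ≠ ⊤) :
    ∫⁻ ω, expNeg (∫⁻ x, f x ∂Φ ω) ∂Pr = expNeg (∫⁻ x, (1 - expNeg (f x)) ∂Λ) := by
  classical
  set S := f.range.filter (· ≠ 0) with hS
  -- Needed twice: for `g = id` against `Φ ω`, and for `g = 1 - expNeg` against `Λ`.
  have hsum : ∀ (μ : Measure E) (g : ℝ≥0∞ → ℝ≥0∞), g 0 = 0 →
      ∫⁻ x, g (f x) ∂μ = ∑ i : Fin S.card, g (S.equivFin.symm i) *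
        μ (f ⁻¹' {(S.equivFin.symm i : ℝ≥0∞)}) := by
    intro μ g hg
    have h1 : ∫⁻ x, g (f x) ∂μ = ∑ y ∈ f.range, g y * μ (f ⁻¹' {y}) := by
      rw [← SimpleFunc.map_lintegral, ← SimpleFunc.lintegral_eq_lintegral]
      rfl
    rw [h1, Equiv.sum_comp S.equivFin.symm (fun y : S => g y * μ (f ⁻¹' {(y : ℝ≥0∞)})),
      Finset.sum_coe_sort S (fun y => g y * μ (f ⁻¹' {y})), hS, Finset.sum_filter_of_ne]
    rintro y - hy rfl
    simp [hg] at hy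
  set A : Fin S.card → Set E := fun i => f ⁻¹' {(S.equivFin.symm i : ℝ≥0∞)} with hA
  have hAm : ∀ i, MeasurableSet (A i) := fun i => f.measurableSet_preimage _
  have hAd : Pairwise (fun i j => Disjoint (A i) (A j)) := by
    intro i j hij
    refine Disjoint.preimage _ (Set.disjoint_singleton.2 fun h => hij ?_)
    exact S.equivFin.symm.injective (Subtype.ext h)
  have hne : ∀ i, (S.equivFin.symm i : ℝ≥0∞) ≠ 0 := fun i =>
    (Finset.mem_filter.1 (S.equivFin.symm i).2).2
  have hnt : ∀ i, (S.equivFin.symm i : ℝ≥0∞) ≠ ⊤ := fun i => by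
    obtain ⟨x, hx⟩ := SimpleFunc.mem_range.1 (Finset.mem_filter.1 (S.equivFin.symm i).2).1
    rw [← hx]
    exact hf x
  have h1 : ∀ ω, ∫⁻ x, f x ∂Φ ω = ∑ i, (S.equivFin.symm i : ℝ≥0∞) * Φ ω (A i) := fun ω =>
    hsum (Φ ω) id rfl
  have h2 := hsum Λ (fun y => 1 - expNeg y) (by simp [expNeg_zero])
  simp_rw [h1, h2, expNeg_sum]
  have hind := (hΦ.indep _ A hAm hAd).comp
    (fun i x => expNeg ((S.equivFin.symm i : ℝ≥0∞) * x))
    (fun i => measurable_expNeg.comp (measurable_const_mul _))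
  have h3 := lintegral_prod_eq_prod_lintegral_of_indepFun Finset.univ _ hind
    (fun i => (measurable_expNeg.comp (measurable_const_mul _)).comp (hΦ.measurable_count (hAm i)))
  simp only [Function.comp_def] at h3
  rw [h3]
  refine Finset.prod_congr rfl fun i _ => ?_
  rw [hΦ.lintegral_expNeg_count (hAm i) (hf' _ (hne i)) (hnt i), mul_comm]

/-- The Laplace functional of a Poisson process with σ-finite intensity. -/
theorem lintegral_expNeg [IsProbabilityMeasure Pr] [SigmaFinite Λ]
    (hΦ : IsPoissonProcess Φ Λ Pr) {f : E → ℝ≥0∞} (hf : Measurable f) :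
    ∫⁻ ω, expNeg (∫⁻ x, f x ∂Φ ω) ∂Pr = expNeg (∫⁻ x, (1 - expNeg (f x)) ∂Λ) := by
  -- The cut-off to spanning sets gives the nonzero fibres finite intensity; `eapprox` keeps the
  -- values finite.
  set g : ℕ → SimpleFunc E ℝ≥0∞ := fun n => (SimpleFunc.eapprox f n).restrict (spanningSets Λ n)
    with hg
  have hgx : ∀ n x, g n x = (spanningSets Λ n).indicator (SimpleFunc.eapprox f n) x := fun n x =>
    SimpleFunc.restrict_apply _ (measurableSet_spanningSets Λ n) x
  have hmono : ∀ x, Monotone fun n => g n x := by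
    intro x m n hmn
    simp only [hgx]
    exact (Set.indicator_le_indicator_of_subset (monotone_spanningSets Λ hmn)
      (fun _ => zero_le) x).trans
        (Set.indicator_le_indicator (SimpleFunc.monotone_eapprox f hmn x))
  have hlim : ∀ x, Filter.Tendsto (fun n => g n x) Filter.atTop (nhds (f x)) := by
    intro x
    refine (SimpleFunc.tendsto_eapprox hf x).congr' ?_
    filter_upwards [Filter.eventually_ge_atTop (spanningSetsIndex Λ x)] with n hn
    rw [hgx, Set.indicator_of_mem (monotone_spanningSets Λ hn (mem_spanningSetsIndex Λ x))]
  have hstep : ∀ n, ∫⁻ ω, expNeg (∫⁻ x, g n x ∂Φ ω) ∂Pr =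
      expNeg (∫⁻ x, (1 - expNeg (g n x)) ∂Λ) := by
    intro n
    refine hΦ.lintegral_expNeg_simpleFunc (g n) (fun x => ?_) (fun y hy => ?_)
    · rw [hgx]
      refine ne_top_of_le_ne_top (SimpleFunc.eapprox_lt_top f n x).ne
        (Set.indicator_le_self' (fun _ _ => zero_le) x)
    · refine ne_top_of_le_ne_top (measure_spanningSets_lt_top Λ n).ne (measure_mono fun x hx => ?_)
      by_contra hxn
      apply hy
      rw [← (hx : g n x = y), hgx, Set.indicator_of_notMem hxn]
  -- The inner integrals converge monotonically on both sides; the outer expectation passes to the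
  -- limit by domination by `1`.
  have hL : Filter.Tendsto (fun n => ∫⁻ ω, expNeg (∫⁻ x, g n x ∂Φ ω) ∂Pr) Filter.atTop
      (nhds (∫⁻ ω, expNeg (∫⁻ x, f x ∂Φ ω) ∂Pr)) := by
    refine tendsto_lintegral_of_dominated_convergence (fun _ => 1)
      (fun n => measurable_expNeg.comp
        ((Measure.measurable_lintegral (g n).measurable).comp hΦ.measurable))
      (fun n => .of_forall fun ω => expNeg_le_one _) (by simp) (.of_forall fun ω => ?_)
    exact (continuous_expNeg.tendsto _).comp
      (lintegral_tendsto_of_tendsto_of_monotone (fun n => (g n).measurable.aemeasurable)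
        (.of_forall hmono) (.of_forall hlim))
  have hR : Filter.Tendsto (fun n => expNeg (∫⁻ x, (1 - expNeg (g n x)) ∂Λ)) Filter.atTop
      (nhds (expNeg (∫⁻ x, (1 - expNeg (f x)) ∂Λ))) := by
    refine (continuous_expNeg.tendsto _).comp (lintegral_tendsto_of_tendsto_of_monotone
      (fun n => (measurable_const.sub (measurable_expNeg.comp (g n).measurable)).aemeasurable)
      (.of_forall fun x m n hmn => tsub_le_tsub_left (antitone_expNeg (hmono x hmn)) 1)
      (.of_forall fun x => ?_))
    exact ENNReal.Tendsto.sub tendsto_const_nhds ((continuous_expNeg.tendsto _).comp (hlim x))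
      (.inl ENNReal.one_ne_top)
  simp_rw [hstep] at hL
  exact tendsto_nhds_unique hL hR

end IsPoissonProcess

/-! ## Mixed Poisson laws -/

lemma measurable_poissonMeasure : Measurable poissonMeasure := by
  refine Measure.measurable_of_measurable_coe _ fun s hs => ?_
  simp only [poissonMeasure, Measure.sum_apply _ hs, Measure.smul_apply]
  refine Measurable.tsum fun n => ?_
  simp only [smul_eq_mul]
  refine Measurable.mul_const ?_ _
  fun_prop

/-- Gamma-Poisson conjugacy: the weighted density is again a gamma density up to a constant, and
that constant is the mixed mass at `n`. The null point `x = 0` is left out so that the power of `x`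
can be split. -/
lemma gammaPDF_mul_poisson {a r l x : ℝ} (ha : 0 < a) (hr : 0 < r) (hl : 0 ≤ l) (n : ℕ)
    (hx : x ≠ 0) :
    gammaPDF a r x * ENNReal.ofReal
        (Real.exp (-((l * x).toNNReal : ℝ)) * ((l * x).toNNReal : ℝ) ^ n / n.factorial) =
      ENNReal.ofReal (r ^ a * Gamma (a + n) * l ^ n /
        (Gamma a * n.factorial * (r + l) ^ (a + n))) * gammaPDF (a + n) (r + l) x := by
  rcases lt_or_gt_of_ne hx with hx | hx
  · rw [gammaPDF_of_neg hx, gammaPDF_of_neg hx, zero_mul, mul_zero]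
  · have h1 : 0 < Gamma a := Gamma_pos_of_pos ha
    have h2 : 0 < Gamma (a + n) := Gamma_pos_of_pos (by positivity)
    have h3 : (0 : ℝ) < (r + l) ^ (a + n) := by positivity
    rw [gammaPDF_of_nonneg hx.le, gammaPDF_of_nonneg hx.le, Real.coe_toNNReal _ (by positivity),
      ← ENNReal.ofReal_mul (by positivity), ← ENNReal.ofReal_mul (by positivity)]
    congr 1
    have h4 : x ^ (a + n - 1) = x ^ (a - 1) * x ^ n := by
      rw [← rpow_add_natCast hx.ne']
      ring_nf
    have h5 : Real.exp (-((r + l) * x)) = Real.exp (-(r * x)) * Real.exp (-(l * x)) := by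
      rw [← Real.exp_add]
      ring_nf
    rw [h4, h5, mul_pow]
    field_simp

lemma gammaMeasure_bind_poissonMeasure_singleton {a r l : ℝ} (ha : 0 < a) (hr : 0 < r)
    (hl : 0 ≤ l) (n : ℕ) :
    (gammaMeasure a r).bind (fun x => poissonMeasure (l * x).toNNReal) {n} =
      ENNReal.ofReal (r ^ a * Gamma (a + n) * l ^ n /
        (Gamma a * n.factorial * (r + l) ^ (a + n))) := by
  have hm : Measurable fun x : ℝ => poissonMeasure (l * x).toNNReal :=
    measurable_poissonMeasure.comp (by fun_prop)
  have hm' : Measurable (gammaPDF a r) := (measurable_gammaPDFReal a r).ennreal_ofReal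
  have hm'' : Measurable (gammaPDF (a + n) (r + l)) :=
    (measurable_gammaPDFReal _ _).ennreal_ofReal
  rw [Measure.bind_apply (measurableSet_singleton n) hm.aemeasurable, gammaMeasure,
    lintegral_withDensity_eq_lintegral_mul _ hm' (g := fun x => poissonMeasure (l * x).toNNReal {n})
      ((Measure.measurable_coe (measurableSet_singleton n)).comp hm)]
  have hae : ∀ᵐ x : ℝ, x ≠ 0 := by simp [ae_iff]
  rw [lintegral_congr_ae (g := fun x => ENNReal.ofReal (r ^ a * Gamma (a + n) * l ^ n /
        (Gamma a * n.factorial * (r + l) ^ (a + n))) * gammaPDF (a + n) (r + l) x)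
    (hae.mono fun x hx => by
      simp only [Pi.mul_apply, poissonMeasure_singleton]
      exact gammaPDF_mul_poisson ha hr hl n hx),
    lintegral_const_mul _ hm'', lintegral_gammaPDF_eq_one (by positivity) (by positivity), mul_one]

/-- The level sets of `N` partition the space and the integrand is bounded, so countable additivity
of the integral also yields the convergence of the series. -/
lemma hasSum_integral_geometric {Ω : Type*} [MeasurableSpace Ω] {Pr : Measure Ω}
    [IsProbabilityMeasure Pr] {N : Ω → ℕ} (hN : Measurable N) {q : ℝ} (hq : 0 ≤ q) (hq' : q ≤ 1)
    (c : ℝ) :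
    HasSum (fun n => Pr.real {ω | N ω = n} * c * q ^ n) (∫ ω, c * q ^ N ω ∂Pr) := by
  have hm : ∀ n : ℕ, MeasurableSet {ω | N ω = n} := fun n => hN (measurableSet_singleton n)
  have hu : (⋃ n : ℕ, {ω | N ω = n}) = Set.univ := by ext ω; simp
  have hint : Integrable (fun ω => c * q ^ N ω) Pr := by
    refine Integrable.const_mul (Integrable.of_bound (C := 1)
      ((measurable_from_nat (f := fun n => q ^ n)).comp hN).aestronglyMeasurable
      (.of_forall fun ω => ?_)) _
    rw [Function.comp_apply, Real.norm_eq_abs, abs_of_nonneg (pow_nonneg hq _)]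
    exact pow_le_one₀ hq hq'
  have h := hasSum_integral_iUnion (μ := Pr) (f := fun ω => c * q ^ N ω) hm
    (fun i j hij => Set.disjoint_left.2 fun ω hi hj => hij ((hi : N ω = i).symm.trans hj))
    hint.integrableOn
  rw [hu, setIntegral_univ] at h
  refine h.congr_fun fun n => ?_
  rw [setIntegral_congr_fun (g := fun _ => c * q ^ n) (hm n)
    (fun ω hω => congrArg (fun k => c * q ^ k) hω), setIntegral_const, smul_eq_mul, mul_assoc]

/-! ## Distance to the nearest point of a planar Poisson process -/

namespace IsPoissonProcess

variable {Ω E : Type*} [MeasurableSpace Ω] [MeasurableSpace E] {Φ : Ω → Measure E}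
  {Λ : Measure E} {Pr : Measure Ω}

lemma measure_count_eq_zero (hΦ : IsPoissonProcess Φ Λ Pr) {A : Set E} (hA : MeasurableSet A)
    (hA' : Λ A ≠ ⊤) :
    Pr {ω | Φ ω A = 0} = ENNReal.ofReal (Real.exp (-(Λ A).toReal)) := by
  have h := DFunLike.congr_fun (hΦ.count_law A hA hA'.lt_top) {0}
  rw [Measure.map_apply (hΦ.measurable_count hA) (measurableSet_singleton _),
    Measure.map_apply .of_discrete (measurableSet_singleton _)] at h
  have h0 : (fun n : ℕ => (n : ℝ≥0∞)) ⁻¹' {0} = {0} := by ext; simp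
  rw [h0, poissonMeasure_singleton] at h
  rw [Nat.factorial_zero, pow_zero, mul_one, Nat.cast_one, div_one] at h
  exact h

end IsPoissonProcess

namespace RachParams

lemma nearestDist_nonneg (φ : Measure Plane) : 0 ≤ nearestDist φ :=
  Real.sInf_nonneg fun _ hr => hr.1

lemma nearestDist_le {φ : Measure Plane} {r : ℝ} (hr : 0 ≤ r)
    (h : φ (Metric.closedBall 0 r) ≠ 0) : nearestDist φ ≤ r :=
  csInf_le (s := {r : ℝ | 0 ≤ r ∧ φ (Metric.closedBall 0 r) ≠ 0})
    ⟨0, fun _ hs => hs.1⟩ ⟨hr, h⟩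

/-- The hypothesis `hφ` excludes the empty configuration, whose `nearestDist` is the default value
`sInf ∅ = 0`. -/
lemma closedBall_ne_zero_of_nearestDist_lt {φ : Measure Plane} {r : ℝ} (h : nearestDist φ < r)
    (hφ : ∃ n : ℕ, φ (Metric.closedBall 0 n) ≠ 0) : φ (Metric.closedBall 0 r) ≠ 0 := by
  obtain ⟨n, hn⟩ := hφ
  have hne : {r : ℝ | 0 ≤ r ∧ φ (Metric.closedBall 0 r) ≠ 0}.Nonempty := ⟨n, n.cast_nonneg, hn⟩
  obtain ⟨s, hs, hsr⟩ := exists_lt_of_csInf_lt hne h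
  intro h0
  exact hs.2 (measure_mono_null (Metric.closedBall_subset_closedBall hsr.le) h0)

lemma measurable_nearestDist : Measurable nearestDist := by
  have hb : ∀ r : ℝ, MeasurableSet {φ : Measure Plane | φ (Metric.closedBall 0 r) = 0} := fun r =>
    Measure.measurable_coe Metric.isClosed_closedBall.measurableSet (measurableSet_singleton 0)
  refine measurable_of_Iio fun r => ?_
  rcases le_or_gt r 0 with hr | hr
  · convert MeasurableSet.empty
    ext φ
    simpa using hr.trans (nearestDist_nonneg φ)
  -- Rational radii make the union countable; the last term collects the empty configurations, where
  -- the default distance `0` is below `r`.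
  have : nearestDist ⁻¹' Set.Iio r =
      (⋃ q : {q : ℚ // 0 ≤ q ∧ (q : ℝ) < r},
        {φ : Measure Plane | φ (Metric.closedBall 0 (q : ℚ)) = 0}ᶜ) ∪
      ⋂ n : ℕ, {φ : Measure Plane | φ (Metric.closedBall 0 n) = 0} := by
    ext φ
    simp only [Set.mem_preimage, Set.mem_Iio, Set.mem_union, Set.mem_iUnion, Set.mem_compl_iff,
      Set.mem_ofPred_eq, Set.mem_iInter]
    constructor
    · intro h
      by_cases hn : ∀ n : ℕ, φ (Metric.closedBall 0 n) = 0
      · exact .inr hn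
      · push Not at hn
        obtain ⟨q, hq, hqr⟩ := exists_rat_btwn h
        have hq0 : (0 : ℝ) ≤ q := (nearestDist_nonneg φ).trans hq.le
        exact .inl ⟨⟨q, by exact_mod_cast hq0, hqr⟩, closedBall_ne_zero_of_nearestDist_lt hq hn⟩
    · rintro (⟨⟨q, hq, hqr⟩, h⟩ | h)
      · exact (nearestDist_le (by exact_mod_cast hq) h).trans_lt hqr
      · have he : {s : ℝ | 0 ≤ s ∧ φ (Metric.closedBall 0 s) ≠ 0} = ∅ := by
          ext s
          simp only [Set.mem_ofPred_eq, Set.mem_empty_iff_false, iff_false, not_and, not_not]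
          intro _
          obtain ⟨n, hn⟩ := exists_nat_ge s
          exact measure_mono_null (Metric.closedBall_subset_closedBall hn) (h n)
        rw [nearestDist, he, Real.sInf_empty]
        exact hr
  rw [this]
  exact (MeasurableSet.iUnion fun q => (hb _).compl).union (MeasurableSet.iInter fun n => hb _)

variable {Ω : Type*} [MeasurableSpace Ω] {Pr : Measure Ω} {Φ : Ω → Measure Plane} {l : ℝ}

lemma ae_cond_nearestDist_nonneg {r : ℝ} (hΦ : Measurable Φ) :
    ∀ᵐ d ∂cond (Pr.map fun ω => nearestDist (Φ ω)) (Set.Iic r), 0 ≤ d := by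
  refine cond_absolutelyContinuous.ae_le
    ((ae_map_iff (measurable_nearestDist.comp hΦ).aemeasurable measurableSet_Ici).2 ?_)
  exact .of_forall fun ω => nearestDist_nonneg _

lemma real_closedBall_eq_zero (hl : 0 < l)
    (hΦ : IsPoissonProcess Φ (ENNReal.ofReal l • (volume : Measure Plane)) Pr) {r : ℝ}
    (hr : 0 ≤ r) :
    Pr.real {ω | Φ ω (Metric.closedBall 0 r) = 0} = Real.exp (-(π * l * r ^ 2)) := by
  have hv : (ENNReal.ofReal l • (volume : Measure Plane)) (Metric.closedBall 0 r) =
      ENNReal.ofReal (π * l * r ^ 2) := by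
    rw [Measure.smul_apply, EuclideanSpace.volume_closedBall_fin_two, smul_eq_mul,
      ← ENNReal.ofReal_pow hr, ← ENNReal.ofReal_mul (by positivity), ← ENNReal.ofReal_mul hl.le]
    ring_nf
  rw [measureReal_def, hΦ.measure_count_eq_zero Metric.isClosed_closedBall.measurableSet
    (by rw [hv]; exact ENNReal.ofReal_ne_top), hv, ENNReal.toReal_ofReal (Real.exp_nonneg _),
    ENNReal.toReal_ofReal (by positivity)]

variable [IsProbabilityMeasure Pr]

lemma real_forall_closedBall_eq_zero (hl : 0 < l)
    (hΦ : IsPoissonProcess Φ (ENNReal.ofReal l • (volume : Measure Plane)) Pr) :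
    Pr.real {ω | ∀ n : ℕ, Φ ω (Metric.closedBall 0 n) = 0} = 0 := by
  refine le_antisymm ?_ measureReal_nonneg
  have ht : Filter.Tendsto (fun n : ℕ => Real.exp (-(π * l * (n : ℝ) ^ 2))) Filter.atTop
      (nhds 0) := by
    refine Real.tendsto_exp_neg_atTop_nhds_zero.comp ?_
    exact Filter.Tendsto.const_mul_atTop (by positivity)
      ((Filter.tendsto_pow_atTop two_ne_zero).comp tendsto_natCast_atTop_atTop)
  refine ge_of_tendsto' ht fun n => ?_
  rw [← real_closedBall_eq_zero hl hΦ n.cast_nonneg]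
  exact measureReal_mono fun ω hω => hω n

/-- A charged ball of radius `r` forces the distance to be at most `r`. Conversely the infimum need
not be attained, so the upper bound comes from radii `s > r`, almost sure non-emptiness and
continuity as `s ↓ r`. -/
lemma real_nearestDist_le (hl : 0 < l)
    (hΦ : IsPoissonProcess Φ (ENNReal.ofReal l • (volume : Measure Plane)) Pr) {r : ℝ}
    (hr : 0 ≤ r) :
    Pr.real {ω | nearestDist (Φ ω) ≤ r} = 1 - Real.exp (-(π * l * r ^ 2)) := by
  have hc : ∀ {s : ℝ}, 0 ≤ s → Pr.real {ω | Φ ω (Metric.closedBall 0 s) ≠ 0} =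
      1 - Real.exp (-(π * l * s ^ 2)) := by
    intro s hs
    rw [← real_closedBall_eq_zero hl hΦ hs, ← probReal_compl_eq_one_sub]
    · rfl
    · exact hΦ.measurable_count Metric.isClosed_closedBall.measurableSet (measurableSet_singleton 0)
  refine le_antisymm ?_ ?_
  · have ht : Filter.Tendsto (fun s : ℝ => 1 - Real.exp (-(π * l * s ^ 2)))
        (nhdsWithin r (Set.Ioi r)) (nhds (1 - Real.exp (-(π * l * r ^ 2)))) :=
      ((by fun_prop : Continuous fun s : ℝ => 1 - Real.exp (-(π * l * s ^ 2))).tendsto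
        r).mono_left nhdsWithin_le_nhds
    refine ge_of_tendsto ht ?_
    filter_upwards [self_mem_nhdsWithin] with s hs
    rw [Set.mem_Ioi] at hs
    rw [← hc (hr.trans hs.le), ← add_zero (Pr.real {ω | Φ ω (Metric.closedBall 0 s) ≠ 0}),
      ← real_forall_closedBall_eq_zero hl hΦ]
    refine (measureReal_mono fun ω hω => ?_).trans (measureReal_union_le _ _)
    by_cases hn : ∀ n : ℕ, Φ ω (Metric.closedBall 0 n) = 0
    · exact .inr hn
    · push Not at hn
      exact .inl (closedBall_ne_zero_of_nearestDist_lt ((hω : _ ≤ r).trans_lt hs) hn)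
  · rw [← hc hr]
    exact measureReal_mono fun ω hω => nearestDist_le hr hω

lemma map_nearestDist_sq (hl : 0 < l)
    (hΦ : IsPoissonProcess Φ (ENNReal.ofReal l • (volume : Measure Plane)) Pr) :
    Pr.map (fun ω => nearestDist (Φ ω) ^ 2) = expMeasure (π * l) := by
  have hm : Measurable fun ω => nearestDist (Φ ω) ^ 2 :=
    (measurable_nearestDist.comp hΦ.measurable).pow_const 2
  have hπ : 0 < π * l := by positivity
  have := isProbabilityMeasure_expMeasure hπ
  have := Measure.isProbabilityMeasure_map (μ := Pr) hm.aemeasurable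
  refine Measure.eq_of_cdf _ _ ?_
  ext t
  rw [cdf_expMeasure_eq hπ, cdf_eq_real, map_measureReal_apply hm measurableSet_Iic]
  split_ifs with ht
  · have : (fun ω => nearestDist (Φ ω) ^ 2) ⁻¹' Set.Iic t =
        {ω | nearestDist (Φ ω) ≤ √t} := by
      ext ω
      simp [Real.le_sqrt (nearestDist_nonneg _), ht]
    rw [this, real_nearestDist_le hl hΦ (Real.sqrt_nonneg t), Real.sq_sqrt ht]
  · have : (fun ω => nearestDist (Φ ω) ^ 2) ⁻¹' Set.Iic t = ∅ := by
      ext ω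
      simp only [Set.mem_preimage, Set.mem_Iic, Set.mem_empty_iff_false, iff_false, not_le]
      exact (not_le.1 ht).trans_le (sq_nonneg _)
    rw [this, measureReal_empty]

lemma setLIntegral_expMeasure_id {r b : ℝ} (hr : 0 < r) (hb : 0 ≤ b) :
    ∫⁻ t in Set.Iic b, ENNReal.ofReal t ∂expMeasure r =
      ENNReal.ofReal (r⁻¹ * lowerGamma 2 (r * b)) := by
  have hm : Measurable (gammaPDF 1 r) := (measurable_gammaPDFReal _ _).ennreal_ofReal
  rw [expMeasure, gammaMeasure, setLIntegral_withDensity_eq_setLIntegral_mul _ hm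
    ENNReal.measurable_ofReal measurableSet_Iic]
  have h1 : ∀ t : ℝ, (gammaPDF 1 r * ENNReal.ofReal) t =
      (Set.Ioi 0).indicator (fun t => ENNReal.ofReal (r * t * Real.exp (-(r * t)))) t := by
    intro t
    change exponentialPDF r t * ENNReal.ofReal t = _
    rcases le_or_gt t 0 with ht | ht
    · rw [Set.indicator_of_notMem (by simpa using ht), ENNReal.ofReal_of_nonpos ht, mul_zero]
    · rw [Set.indicator_of_mem (by simpa using ht), exponentialPDF_of_nonneg ht.le,
        ← ENNReal.ofReal_mul (by positivity)]
      ring_nf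
  simp_rw [h1]
  rw [setLIntegral_indicator measurableSet_Ioi, Set.Ioi_inter_Iic,
    ← ofReal_integral_eq_lintegral_ofReal, ← intervalIntegral.integral_of_le hb,
    intervalIntegral.integral_comp_mul_left (fun u => u * Real.exp (-u)) hr.ne', mul_zero,
    smul_eq_mul, lowerGamma]
  · norm_num
  · exact (by fun_prop : Continuous fun t : ℝ => r * t * Real.exp (-(r * t))).integrableOn_Ioc
  · refine (ae_restrict_iff' measurableSet_Ioc).2 (.of_forall fun t ht => ?_)
    have := ht.1
    simp only [Pi.zero_apply]
    positivity

/-- Conditioning on `d ≤ r` is conditioning the exponential variable `d ^ 2` on being at most `r ^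
2`; its truncated mean is divided by the probability of that event. -/
lemma lintegral_sq_cond_nearestDist (hl : 0 < l)
    (hΦ : IsPoissonProcess Φ (ENNReal.ofReal l • (volume : Measure Plane)) Pr) {r : ℝ}
    (hr : 0 < r) :
    ∫⁻ d, ENNReal.ofReal (d ^ 2) ∂cond (Pr.map fun ω => nearestDist (Φ ω)) (Set.Iic r) =
      ENNReal.ofReal (lowerGamma 2 (π * l * r ^ 2) /
        (π * l * (1 - Real.exp (-(π * l * r ^ 2))))) := by
  have hX : Measurable fun ω => nearestDist (Φ ω) := measurable_nearestDist.comp hΦ.measurable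
  have hπ : 0 < π * l := by positivity
  have hpos : 0 < 1 - Real.exp (-(π * l * r ^ 2)) := by
    rw [sub_pos, Real.exp_lt_one_iff]
    have : 0 < π * l * r ^ 2 := by positivity
    linarith
  rw [ProbabilityTheory.cond, lintegral_smul_measure, Measure.map_apply hX measurableSet_Iic,
    setLIntegral_map measurableSet_Iic (by fun_prop) hX]
  have h1 : (fun ω => nearestDist (Φ ω)) ⁻¹' Set.Iic r =
      (fun ω => nearestDist (Φ ω) ^ 2) ⁻¹' Set.Iic (r ^ 2) := by
    ext ω
    simp only [Set.mem_preimage, Set.mem_Iic]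
    exact (pow_le_pow_iff_left₀ (nearestDist_nonneg _) hr.le two_ne_zero).symm
  have h2 : Pr ((fun ω => nearestDist (Φ ω)) ⁻¹' Set.Iic r) =
      ENNReal.ofReal (1 - Real.exp (-(π * l * r ^ 2))) := by
    rw [← real_nearestDist_le hl hΦ hr.le, ofReal_measureReal]
    rfl
  rw [h2, h1, ← setLIntegral_map (f := ENNReal.ofReal) measurableSet_Iic (by fun_prop)
    (hX.pow_const 2), map_nearestDist_sq hl hΦ, setLIntegral_expMeasure_id hπ (by positivity),
    smul_eq_mul, ← ENNReal.ofReal_inv_of_pos hpos, ← ENNReal.ofReal_mul (by positivity)]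
  congr 1
  field_simp

lemma isProbabilityMeasure_cond_nearestDist (hl : 0 < l)
    (hΦ : IsPoissonProcess Φ (ENNReal.ofReal l • (volume : Measure Plane)) Pr) {r : ℝ}
    (hr : 0 < r) :
    IsProbabilityMeasure (cond (Pr.map fun ω => nearestDist (Φ ω)) (Set.Iic r)) := by
  have hX : Measurable fun ω => nearestDist (Φ ω) := measurable_nearestDist.comp hΦ.measurable
  have := Measure.isProbabilityMeasure_map (μ := Pr) hX.aemeasurable
  refine cond_isProbabilityMeasure ?_
  rw [← measureReal_ne_zero_iff, map_measureReal_apply hX measurableSet_Iic]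
  have h1 : (fun ω => nearestDist (Φ ω)) ⁻¹' Set.Iic r = {ω | nearestDist (Φ ω) ≤ r} := rfl
  rw [h1, real_nearestDist_le hl hΦ hr.le, sub_ne_zero]
  refine (Real.exp_lt_one_iff.2 ?_).ne'
  have : 0 < π * l * r ^ 2 := by positivity
  linarith

end RachParams

/-! ## Exponential fading -/

/-- Exponential tilting: `e^{-ag}` times the `Exp(1)` density is `1/(1+a)` times the `Exp(1+a)`
density. -/
lemma lintegral_expNeg_expMeasure {a : ℝ} (ha : 0 ≤ a) :
    ∫⁻ g, expNeg (ENNReal.ofReal (a * g)) ∂expMeasure 1 = ENNReal.ofReal (1 / (1 + a)) := by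
  have hm : ∀ r, Measurable (exponentialPDF r) := fun r =>
    (measurable_exponentialPDFReal r).ennreal_ofReal
  have h : ∀ g, exponentialPDF 1 g * expNeg (ENNReal.ofReal (a * g)) =
      ENNReal.ofReal (1 / (1 + a)) * exponentialPDF (1 + a) g := by
    intro g
    rcases lt_or_ge g 0 with hg | hg
    · rw [exponentialPDF_of_neg hg, exponentialPDF_of_neg hg, zero_mul, mul_zero]
    · rw [exponentialPDF_of_nonneg hg, exponentialPDF_of_nonneg hg, expNeg_ofReal (by positivity),
        ← ENNReal.ofReal_mul (by positivity), ← ENNReal.ofReal_mul (by positivity)]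
      congr 1
      rw [one_mul, one_mul, ← Real.exp_add, ← mul_assoc, one_div_mul_cancel (by positivity),
        one_mul]
      ring_nf
  have h1 : expMeasure 1 = volume.withDensity (exponentialPDF 1) := rfl
  rw [h1, lintegral_withDensity_eq_lintegral_mul _ (hm 1)
    (g := fun g => expNeg (ENNReal.ofReal (a * g))) (by fun_prop)]
  have h2 : ∀ g, (exponentialPDF 1 * fun g => expNeg (ENNReal.ofReal (a * g))) g =
      ENNReal.ofReal (1 / (1 + a)) * exponentialPDF (1 + a) g := h
  simp_rw [h2]
  rw [lintegral_const_mul _ (hm _), lintegral_exponentialPDF_eq_one (by positivity), mul_one]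

/-- The threshold `c` may be infinite, because the interference is not known to be finite. -/
lemma expMeasure_le_ofReal_mul {r : ℝ} (hr : 0 < r) (c : ℝ≥0∞) :
    expMeasure 1 {g | c ≤ ENNReal.ofReal (r * g)} = expNeg (c / ENNReal.ofReal r) := by
  have := isProbabilityMeasure_expMeasure one_pos
  induction c with
  | top => simp [ENNReal.top_div_of_ne_top, expNeg_top]
  | coe c =>
    have hc : (0 : ℝ) ≤ c / r := by positivity
    have h1 : ((c : ℝ≥0∞) / ENNReal.ofReal r) = ENNReal.ofReal (c / r) := by
      rw [ENNReal.ofReal_div_of_pos hr, ENNReal.ofReal_coe_nnreal]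
    -- The sets differ at the endpoint, and for `c = 0` also on negative `g`, where `ENNReal.ofReal`
    -- truncates; both are null.
    have h2 : ({g | (c : ℝ≥0∞) ≤ ENNReal.ofReal (r * g)} : Set ℝ) =ᵐ[expMeasure 1]
        ((Set.Iic (c / r : ℝ))ᶜ : Set ℝ) := by
      have hne : ∀ᵐ g ∂expMeasure 1, g ≠ (c / r : ℝ) := by
        have : expMeasure 1 ≪ volume := withDensity_absolutelyContinuous _ _
        exact this.ae_le (Measure.ae_ne volume _)
      have hpos : ∀ᵐ g ∂expMeasure 1, 0 ≤ g := by
        rw [ae_iff, ← measureReal_eq_zero_iff]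
        refine le_antisymm ?_ measureReal_nonneg
        have h0 := cdf_expMeasure_eq one_pos 0
        rw [cdf_eq_real] at h0
        norm_num at h0
        exact (measureReal_mono (s₂ := Set.Iic (0 : ℝ)) fun x (hx : ¬ 0 ≤ x) =>
          (not_le.1 hx).le).trans_eq h0
      filter_upwards [hne, hpos] with g hg hg0
      refine propext ?_
      change (c : ℝ≥0∞) ≤ ENNReal.ofReal (r * g) ↔ ¬ g ≤ c / r
      rw [← ENNReal.ofReal_coe_nnreal, ENNReal.ofReal_le_ofReal_iff (by positivity), not_le,
        ← div_le_iff₀' hr]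
      exact ⟨fun h => lt_of_le_of_ne h hg.symm, le_of_lt⟩
    rw [measure_congr h2, h1, expNeg_ofReal hc, ← ofReal_measureReal,
      probReal_compl_eq_one_sub measurableSet_Iic, ← cdf_eq_real, cdf_expMeasure_eq one_pos,
      if_pos hc]
    norm_num

lemma lintegral_expNeg_sum_pi {ι : Type*} [Fintype ι] (T : Finset ι) {a : ℝ} (ha : 0 ≤ a) :
    ∫⁻ g : ι → ℝ, expNeg (∑ s ∈ T, ENNReal.ofReal (a * g s)) ∂Measure.pi (fun _ => expMeasure 1) =
      ENNReal.ofReal ((1 / (1 + a)) ^ T.card) := by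
  have := isProbabilityMeasure_expMeasure one_pos
  have hm : Measurable fun g : ℝ => expNeg (ENNReal.ofReal (a * g)) :=
    measurable_expNeg.comp (by fun_prop)
  have hind : iIndepFun (fun (s : ι) (g : ι → ℝ) => expNeg (ENNReal.ofReal (a * g s)))
      (Measure.pi fun _ => expMeasure 1) :=
    iIndepFun_pi (X := fun _ g => expNeg (ENNReal.ofReal (a * g))) fun _ => hm.aemeasurable
  simp_rw [expNeg_sum]
  rw [lintegral_prod_eq_prod_lintegral_of_indepFun T _ hind
    fun s => hm.comp (measurable_pi_apply s)]
  have h : ∀ s : ι, ∫⁻ g : ι → ℝ, expNeg (ENNReal.ofReal (a * g s))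
      ∂Measure.pi (fun _ => expMeasure 1) = ENNReal.ofReal (1 / (1 + a)) := fun s => by
    rw [← lintegral_expNeg_expMeasure ha]
    exact (measurePreserving_eval (fun _ : ι => expMeasure 1) s).lintegral_comp hm
  simp_rw [h]
  rw [Finset.prod_const, ENNReal.ofReal_pow (by positivity)]

lemma lintegral_one_sub_expNeg_sum_pi {ι : Type*} [Fintype ι] (T : Finset ι) {a : ℝ}
    (ha : 0 ≤ a) :
    ∫⁻ g : ι → ℝ, (1 - expNeg (∑ s ∈ T, ENNReal.ofReal (a * g s)))
        ∂Measure.pi (fun _ => expMeasure 1) =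
      ENNReal.ofReal (1 - (1 / (1 + a)) ^ T.card) := by
  have := isProbabilityMeasure_expMeasure one_pos
  rw [lintegral_sub (by fun_prop), lintegral_expNeg_sum_pi T ha,
    lintegral_one, measure_univ, ENNReal.ofReal_sub _ (by positivity), ENNReal.ofReal_one]
  · rw [lintegral_expNeg_sum_pi T ha]
    exact ENNReal.ofReal_ne_top
  · exact .of_forall fun g => expNeg_le_one _

/-! ## The spatial integral -/

lemma one_sub_pow_nonneg {u : ℝ} (hu : 0 ≤ u) (l : ℕ) : 0 ≤ 1 - (1 / (1 + u)) ^ l :=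
  sub_nonneg.2 (pow_le_one₀ (by positivity) ((div_le_one (by positivity)).2 (by linarith)))

lemma one_sub_pow_le {u : ℝ} (hu : 0 ≤ u) (l : ℕ) : 1 - (1 / (1 + u)) ^ l ≤ l * u := by
  have h1 : 1 / (1 + u) = 1 + -(u / (1 + u)) := by field_simp; ring
  have h2 : u / (1 + u) ≤ u := div_le_self hu (by linarith)
  have h3 : 0 ≤ u / (1 + u) := by positivity
  have h4 : u / (1 + u) ≤ 1 := (div_le_one (by positivity)).2 (by linarith)
  have := one_add_mul_le_pow (a := -(u / (1 + u))) (by linarith) l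
  rw [h1]
  nlinarith [(Nat.cast_nonneg l : (0 : ℝ) ≤ l)]

/-- Bernoulli's inequality bounds the integrand by `l * y ^ (1 - α)`, which is integrable at
infinity exactly because `α > 2`; the origin is cut off. -/
lemma integrableOn_one_sub_pow_mul {α a : ℝ} (hα : 2 < α) (ha : 0 < a) (l : ℕ) :
    IntegrableOn (fun y : ℝ => (1 - (1 / (1 + y ^ (-α))) ^ l) * y) (Set.Ioi a) := by
  have h : IntegrableOn (fun y : ℝ => l * y ^ (1 - α)) (Set.Ioi a) :=
    (integrableOn_Ioi_rpow_of_lt (by linarith) ha).const_mul _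
  refine Integrable.mono' h (by fun_prop) ?_
  refine (ae_restrict_iff' measurableSet_Ioi).2 (.of_forall fun y hy => ?_)
  have hy : 0 < y := ha.trans hy
  have hu : 0 ≤ y ^ (-α) := by positivity
  rw [Real.norm_eq_abs, abs_of_nonneg (mul_nonneg (one_sub_pow_nonneg hu l) hy.le)]
  have h1 : y ^ (1 - α) = y ^ (-α) * y := by
    rw [sub_eq_neg_add, rpow_add_one hy.ne']
  rw [h1, ← mul_assoc]
  exact mul_le_mul_of_nonneg_right (one_sub_pow_le hu l) hy.le

lemma lintegral_norm_plane {f : ℝ → ℝ} (hf : ∀ r, 0 ≤ f r)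
    (hint : IntegrableOn (fun r => r * f r) (Set.Ioi 0)) :
    ∫⁻ x : Plane, ENNReal.ofReal (f ‖x‖) =
      ENNReal.ofReal (2 * π * ∫ r in Set.Ioi (0 : ℝ), r * f r) := by
  have hd : Module.finrank ℝ Plane = 2 := by simp
  have hi : Integrable fun x : Plane => f ‖x‖ := by
    rw [integrable_fun_norm_addHaar, hd]
    simpa using hint
  rw [← ofReal_integral_eq_lintegral_ofReal hi (.of_forall fun x => hf _),
    integral_fun_norm_addHaar, hd, measureReal_def, EuclideanSpace.volume_ball_fin_two]
  simp [Real.pi_nonneg, mul_assoc]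

namespace RachParams

variable {p : RachParams}

lemma F0_nonneg (hp : p.Admissible) (l : ℕ) : 0 ≤ p.F0 l := by
  refine setIntegral_nonneg measurableSet_Ioi fun y hy => ?_
  have hγ := hp.gammaTh_pos
  have hy : 0 < y := lt_of_le_of_lt (by positivity) hy
  exact mul_nonneg (one_sub_pow_nonneg (by positivity) l) hy.le

/-- Scaling by `k = d γ^{1/α}` removes `d` from the integrand and moves the cut-off `d ≤ ‖x‖` to
`γ^{-1/α} ≤ y`. What remains of `d` is the Jacobian `d ^ 2`. -/
lemma lintegral_plane_one_sub_pow (hp : p.Admissible) (l : ℕ) {d : ℝ} (hd : 0 ≤ d) :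
    ∫⁻ x : Plane, {x : Plane | d ≤ ‖x‖}.indicator (fun x => ENNReal.ofReal
        (1 - (1 / (1 + p.gammaTh * d ^ p.alpha * ‖x‖ ^ (-p.alpha))) ^ l)) x =
      ENNReal.ofReal (2 * π * p.gammaTh ^ (2 / p.alpha) * p.F0 l) * ENNReal.ofReal (d ^ 2) := by
  have hγ := hp.gammaTh_pos
  have hα : 0 < p.alpha := two_pos.trans hp.two_lt_alpha
  rcases hd.eq_or_lt with rfl | hd
  -- At `d = 0` the transmit power vanishes and both sides are zero, so the scaling factor may be
  -- assumed positive.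
  · simp [Real.zero_rpow hα.ne']
  set φ : ℝ → ℝ := fun y => (1 - (1 / (1 + y ^ (-p.alpha))) ^ l) * y with hφ
  set k : ℝ := d * p.gammaTh ^ (1 / p.alpha) with hk
  have hk0 : 0 < k := by positivity
  set f : ℝ → ℝ := (Set.Ici d).indicator fun r =>
    1 - (1 / (1 + p.gammaTh * d ^ p.alpha * r ^ (-p.alpha))) ^ l with hf
  have hf0 : ∀ r, 0 ≤ f r := fun r => by
    refine Set.indicator_nonneg (fun r hr => ?_) r
    have : 0 < r := hd.trans_le hr
    exact one_sub_pow_nonneg (by positivity) l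
  have hkd : k⁻¹ * d = p.gammaTh ^ (-1 / p.alpha) := by
    rw [hk, neg_div, rpow_neg hγ.le]
    field_simp
  have hfφ : ∀ r ∈ Set.Ioi (0 : ℝ), r * f r = (Set.Ici d).indicator (fun r => k * φ (k⁻¹ * r)) r := by
    intro r hr
    have hr : 0 < r := hr
    by_cases hrd : r ∈ Set.Ici d
    · rw [hf, Set.indicator_of_mem hrd, Set.indicator_of_mem hrd, hφ]
      have h1 : (k⁻¹ * r) ^ (-p.alpha) = p.gammaTh * d ^ p.alpha * r ^ (-p.alpha) := by
        rw [mul_rpow (by positivity) hr.le, inv_rpow hk0.le, rpow_neg hk0.le, inv_inv, hk,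
          mul_rpow hd.le (by positivity), ← rpow_mul hγ.le, one_div_mul_cancel hα.ne', rpow_one]
        ring
      simp only [h1]
      field_simp
    · rw [hf, Set.indicator_of_notMem hrd, Set.indicator_of_notMem hrd, mul_zero]
  have hsub : Set.Ici d ∩ Set.Ioi 0 = Set.Ici d :=
    Set.inter_eq_left.2 fun r hr => hd.trans_le hr
  have hφi : IntegrableOn (fun r => k * φ (k⁻¹ * r)) (Set.Ici d) := by
    rw [integrableOn_Ici_iff_integrableOn_Ioi]
    refine Integrable.const_mul ?_ k
    refine (integrableOn_Ioi_comp_mul_left_iff φ d (inv_pos.2 hk0)).2 ?_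
    rw [hkd]
    exact integrableOn_one_sub_pow_mul hp.two_lt_alpha (by positivity) l
  have hint : IntegrableOn (fun r => r * f r) (Set.Ioi 0) := by
    refine (integrableOn_congr_fun hfφ measurableSet_Ioi).2 ?_
    rw [IntegrableOn, integrable_indicator_iff measurableSet_Ici, IntegrableOn,
      Measure.restrict_restrict measurableSet_Ici, hsub]
    exact hφi
  have hval : ∫ r in Set.Ioi (0 : ℝ), r * f r = k ^ 2 * p.F0 l := by
    rw [setIntegral_congr_fun measurableSet_Ioi hfφ, setIntegral_indicator measurableSet_Ici,
      Set.inter_comm, hsub, integral_Ici_eq_integral_Ioi, integral_const_mul,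
      integral_comp_mul_left_Ioi φ d (inv_pos.2 hk0), hkd, inv_inv, smul_eq_mul, F0]
    ring
  have hx : ∀ x : Plane, {x : Plane | d ≤ ‖x‖}.indicator (fun x => ENNReal.ofReal
      (1 - (1 / (1 + p.gammaTh * d ^ p.alpha * ‖x‖ ^ (-p.alpha))) ^ l)) x =
      ENNReal.ofReal (f ‖x‖) := by
    intro x
    by_cases h : d ≤ ‖x‖
    · rw [Set.indicator_of_mem (by exact h), hf, Set.indicator_of_mem (by exact h)]
    · rw [Set.indicator_of_notMem (by exact h), hf, Set.indicator_of_notMem (by exact h),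
        ENNReal.ofReal_zero]
  simp_rw [hx]
  rw [lintegral_norm_plane hf0 hint, hval, ← ENNReal.ofReal_mul' (by positivity)]
  congr 1
  have h2 : k ^ 2 = d ^ 2 * p.gammaTh ^ (2 / p.alpha) := by
    rw [hk, mul_pow, ← rpow_natCast (p.gammaTh ^ (1 / p.alpha)), ← rpow_mul hγ.le]
    congr 2
    push_cast
    ring
  rw [h2]
  ring

/-- Aggregate contribution of one potential interferer, relative to the threshold, over the symbol
groups in `T`. -/
noncomputable def thresholdLoad (p : RachParams) (T : Finset (SymbolGroup p.K0)) :
    Interferer p.K0 → ℝ≥0∞ :=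
  {y : Interferer p.K0 | y.2.1 ≤ ‖y.1‖}.indicator fun y =>
    ∑ s ∈ T, ENNReal.ofReal (p.gammaTh * y.2.1 ^ p.alpha * ‖y.1‖ ^ (-p.alpha) * y.2.2 s)

lemma measurableSet_dist_le_norm {K : ℕ} :
    MeasurableSet {y : Interferer K | y.2.1 ≤ ‖y.1‖} :=
  measurableSet_le (by fun_prop) (by fun_prop)

lemma measurable_thresholdLoad (T : Finset (SymbolGroup p.K0)) :
    Measurable (p.thresholdLoad T) :=
  Measurable.indicator (by fun_prop) measurableSet_dist_le_norm

/-- Makes the conditional success exponent a single linear functional of `z`, the form the Laplace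
functional requires; `rho` cancels by power control. -/
lemma sum_mul_interference (hp : p.Admissible) (z : Measure (Interferer p.K0))
    (T : Finset (SymbolGroup p.K0)) :
    ∑ s ∈ T, ENNReal.ofReal (p.gammaTh / p.rho) * p.interference z s =
      ∫⁻ y, p.thresholdLoad T y ∂z := by
  have hγ := hp.gammaTh_pos
  have hρ := hp.rho_pos
  unfold thresholdLoad interference
  rw [lintegral_indicator measurableSet_dist_le_norm, lintegral_finsetSum _ fun s _ => by fun_prop]
  refine Finset.sum_congr rfl fun s _ => ?_
  rw [← lintegral_const_mul _ (by fun_prop)]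
  refine lintegral_congr fun y => ?_
  rw [← ENNReal.ofReal_mul (by positivity)]
  congr 1
  field_simp

lemma lintegral_prod_one_sub_expNeg_thresholdLoad (hp : p.Admissible) {ν : Measure ℝ} [SFinite ν]
    (hν : ∀ᵐ d ∂ν, 0 ≤ d) (T : Finset (SymbolGroup p.K0)) :
    ∫⁻ y, (1 - expNeg (p.thresholdLoad T y))
        ∂((volume : Measure Plane).prod (ν.prod (Measure.pi fun _ => expMeasure 1))) =
      ENNReal.ofReal (2 * π * p.gammaTh ^ (2 / p.alpha) * p.F0 T.card) *
        ∫⁻ d, ENNReal.ofReal (d ^ 2) ∂ν := by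
  have := isProbabilityMeasure_expMeasure one_pos
  have hγ := hp.gammaTh_pos
  have hm : Measurable fun y : Interferer p.K0 => 1 - expNeg (p.thresholdLoad T y) :=
    measurable_const.sub (measurable_expNeg.comp (measurable_thresholdLoad T))
  set κ : Plane → ℝ → ℝ≥0∞ := fun x d => {x : Plane | d ≤ ‖x‖}.indicator (fun x => ENNReal.ofReal
        (1 - (1 / (1 + p.gammaTh * d ^ p.alpha * ‖x‖ ^ (-p.alpha))) ^ T.card)) x with hκ
  have hκm : Measurable (Function.uncurry κ) := by
    have : Function.uncurry κ = {q : Plane × ℝ | q.2 ≤ ‖q.1‖}.indicator fun q => ENNReal.ofReal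
        (1 - (1 / (1 + p.gammaTh * q.2 ^ p.alpha * ‖q.1‖ ^ (-p.alpha))) ^ T.card) := by
      ext q
      rfl
    rw [this]
    exact Measurable.indicator (by fun_prop) (measurableSet_le (by fun_prop) (by fun_prop))
  have hin : ∀ x : Plane, ∀ d : ℝ, 0 ≤ d →
      ∫⁻ g, (1 - expNeg (p.thresholdLoad T (x, d, g))) ∂Measure.pi (fun _ => expMeasure 1) =
        κ x d := by
    intro x d hd
    by_cases h : d ≤ ‖x‖
    · have h1 : ∀ g, p.thresholdLoad T (x, d, g) = ∑ s ∈ T, ENNReal.ofReal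
          (p.gammaTh * d ^ p.alpha * ‖x‖ ^ (-p.alpha) * g s) := fun g =>
        Set.indicator_of_mem (s := {y : Interferer p.K0 | y.2.1 ≤ ‖y.1‖}) h _
      simp_rw [h1]
      rw [lintegral_one_sub_expNeg_sum_pi T (by positivity), hκ]
      symm
      exact Set.indicator_of_mem (s := {x : Plane | d ≤ ‖x‖}) h _
    · have h1 : ∀ g, p.thresholdLoad T (x, d, g) = 0 := fun g =>
        Set.indicator_of_notMem (s := {y : Interferer p.K0 | y.2.1 ≤ ‖y.1‖}) h _
      simp_rw [h1]
      rw [expNeg_zero, tsub_self, lintegral_zero, hκ]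
      symm
      exact Set.indicator_of_notMem (s := {x : Plane | d ≤ ‖x‖}) h _
  rw [lintegral_prod _ hm.aemeasurable]
  have h1 : ∀ x : Plane, ∫⁻ q, (1 - expNeg (p.thresholdLoad T (x, q)))
      ∂(ν.prod (Measure.pi fun _ => expMeasure 1)) = ∫⁻ d, κ x d ∂ν := by
    intro x
    rw [lintegral_prod (fun q => 1 - expNeg (p.thresholdLoad T (x, q)))
      (hm.comp (by fun_prop : Measurable fun q => (x, q))).aemeasurable]
    exact lintegral_congr_ae (hν.mono fun d hd => hin x d hd)
  simp_rw [h1]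
  -- Integrating over positions first leaves a constant times `d ^ 2`.
  rw [lintegral_lintegral_swap hκm.aemeasurable,
    lintegral_congr_ae (hν.mono fun d hd => lintegral_plane_one_sub_pow hp T.card hd),
    lintegral_const_mul _ (by fun_prop)]

/-! ### Network parameters and the exponent of the interference -/

lemma nonEmptyProb_eq (p : RachParams) : p.nonEmptyProb = 1 - Real.exp (-(p.muNew : ℝ)) := by
  have h : {n : ℕ | 0 < n} = {0}ᶜ := by
    ext n
    exact Nat.pos_iff_ne_zero
  rw [nonEmptyProb, h, probReal_compl_eq_one_sub (measurableSet_singleton 0),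
    poissonMeasure_real_singleton]
  simp

lemma activeDensity_nonneg (hp : p.Admissible) : 0 ≤ p.activeDensity := by
  have h1 : 0 ≤ p.nonEmptyProb := measureReal_nonneg
  have h2 : 0 ≤ p.lam0a := by
    refine div_nonneg (mul_nonneg ?_ hp.lamD_pos.le) (Nat.cast_nonneg _)
    have : 0 ≤ p.lamB * π * p.D0 ^ 2 := by
      have := hp.lamB_pos
      positivity
    rw [sub_nonneg, Real.exp_le_one_iff]
    linarith
  exact mul_nonneg (mul_nonneg h1 hp.R_nonneg) h2

variable {Ω : Type*} [MeasurableSpace Ω] {Pr : Measure Ω} [IsProbabilityMeasure Pr]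
  {ΦB : Ω → Measure Plane}

lemma isProbabilityMeasure_servingDistLaw (hp : p.Admissible)
    (hΦB : IsPoissonProcess ΦB (ENNReal.ofReal p.lamB • (volume : Measure Plane)) Pr) :
    IsProbabilityMeasure (p.servingDistLaw ΦB Pr) :=
  isProbabilityMeasure_cond_nearestDist hp.lamB_pos hΦB
    (rpow_pos_of_pos (div_pos hp.pUL_pos hp.rho_pos) _)

lemma lintegral_sq_servingDistLaw (hp : p.Admissible)
    (hΦB : IsPoissonProcess ΦB (ENNReal.ofReal p.lamB • (volume : Measure Plane)) Pr) :
    ∫⁻ d, ENNReal.ofReal (d ^ 2) ∂p.servingDistLaw ΦB Pr =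
      ENNReal.ofReal (lowerGamma 2 (π * p.lamB * (p.pUL / p.rho) ^ (2 / p.alpha)) /
        (π * p.lamB * (1 - Real.exp (-(π * p.lamB * (p.pUL / p.rho) ^ (2 / p.alpha)))))) := by
  have h0 : 0 < p.pUL / p.rho := div_pos hp.pUL_pos hp.rho_pos
  have h : (p.pUL / p.rho) ^ (2 / p.alpha) = ((p.pUL / p.rho) ^ (1 / p.alpha)) ^ 2 := by
    rw [← rpow_natCast, ← rpow_mul h0.le]
    congr 1
    push_cast
    ring
  rw [h]
  exact lintegral_sq_cond_nearestDist hp.lamB_pos hΦB (rpow_pos_of_pos h0 _)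

/-- The exponent in the Laplace functional of the interference over `l` symbol groups. -/
noncomputable def laplaceExponent (p : RachParams) (l : ℕ) : ℝ :=
  2 * p.gammaTh ^ (2 / p.alpha) * p.activeDensity *
      lowerGamma 2 (π * p.lamB * (p.pUL / p.rho) ^ (2 / p.alpha)) /
    (p.lamB * (1 - Real.exp (-(π * p.lamB * (p.pUL / p.rho) ^ (2 / p.alpha))))) * p.F0 l

lemma lowerGamma_two_nonneg {b : ℝ} (hb : 0 ≤ b) : 0 ≤ lowerGamma 2 b := by
  refine intervalIntegral.integral_nonneg hb fun t ht => ?_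
  have := ht.1
  positivity

lemma one_sub_exp_pos (hp : p.Admissible) :
    0 < 1 - Real.exp (-(π * p.lamB * (p.pUL / p.rho) ^ (2 / p.alpha))) := by
  have h0 : 0 < p.pUL / p.rho := div_pos hp.pUL_pos hp.rho_pos
  have h1 := hp.lamB_pos
  have : 0 < π * p.lamB * (p.pUL / p.rho) ^ (2 / p.alpha) := by positivity
  rw [sub_pos, Real.exp_lt_one_iff]
  linarith

lemma laplaceExponent_nonneg (hp : p.Admissible) (l : ℕ) : 0 ≤ p.laplaceExponent l := by
  have h0 : 0 < p.pUL / p.rho := div_pos hp.pUL_pos hp.rho_pos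
  have h1 := hp.lamB_pos
  have h2 := hp.gammaTh_pos
  have h3 := one_sub_exp_pos hp
  have h4 := F0_nonneg hp l
  have h5 := activeDensity_nonneg hp
  have h6 := lowerGamma_two_nonneg
    (by positivity : 0 ≤ π * p.lamB * (p.pUL / p.rho) ^ (2 / p.alpha))
  unfold laplaceExponent
  positivity

lemma lintegral_one_sub_expNeg_thresholdLoad (hp : p.Admissible)
    (hΦB : IsPoissonProcess ΦB (ENNReal.ofReal p.lamB • (volume : Measure Plane)) Pr)
    (T : Finset (SymbolGroup p.K0)) :
    ∫⁻ y, (1 - expNeg (p.thresholdLoad T y)) ∂p.interfererIntensity ΦB Pr =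
      ENNReal.ofReal (p.laplaceExponent T.card) := by
  have := isProbabilityMeasure_servingDistLaw hp hΦB
  have h1 := hp.gammaTh_pos
  have h2 := F0_nonneg hp T.card
  have h3 := activeDensity_nonneg hp
  have h4 := (one_sub_exp_pos hp).ne'
  have h5 := hp.lamB_pos.ne'
  rw [interfererIntensity, lintegral_smul_measure, lintegral_prod_one_sub_expNeg_thresholdLoad hp
    (ν := p.servingDistLaw ΦB Pr) (ae_cond_nearestDist_nonneg hΦB.measurable) T,
    lintegral_sq_servingDistLaw hp hΦB, smul_eq_mul,
    ← ENNReal.ofReal_mul (by positivity), ← ENNReal.ofReal_mul h3, laplaceExponent]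
  congr 1
  field_simp

lemma lintegral_expNeg_lintegral_thresholdLoad (hp : p.Admissible)
    (hΦB : IsPoissonProcess ΦB (ENNReal.ofReal p.lamB • (volume : Measure Plane)) Pr)
    {Z : Ω → Measure (Interferer p.K0)}
    (hZ : IsPoissonProcess Z (p.interfererIntensity ΦB Pr) Pr) (T : Finset (SymbolGroup p.K0)) :
    ∫⁻ ω, expNeg (∫⁻ y, p.thresholdLoad T y ∂Z ω) ∂Pr =
      ENNReal.ofReal (Real.exp (-p.laplaceExponent T.card)) := by
  have := isProbabilityMeasure_servingDistLaw hp hΦB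
  have := isProbabilityMeasure_expMeasure one_pos
  have : SigmaFinite (p.interfererIntensity ΦB Pr) := by
    exact SMul.sigmaFinite (Real.toNNReal p.activeDensity)
  rw [hZ.lintegral_expNeg (measurable_thresholdLoad T),
    lintegral_one_sub_expNeg_thresholdLoad hp hΦB T, expNeg_ofReal (laplaceExponent_nonneg hp _)]

end RachParams

/-! ## Success probabilities -/

lemma sum_powerset_nonempty_apply_card {ι : Type*} (s : Finset ι) (f : ℕ → ℝ) :
    ∑ u ∈ s.powerset with u.Nonempty, f u.card =
      ∑ k ∈ Finset.Icc 1 s.card, (s.card.choose k : ℝ) * f k := by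
  -- Setting the summand to zero at cardinality `0` encodes non-emptiness, so the formula for the
  -- whole powerset applies.
  have h1 : ∀ u : Finset ι, (if u.Nonempty then f u.card else 0) =
      (fun k => if k = 0 then 0 else f k) u.card := by
    intro u
    rcases u.eq_empty_or_nonempty with rfl | hu
    · simp
    · simp [hu, hu.ne_empty]
  rw [Finset.sum_filter, Finset.sum_congr rfl fun u _ => h1 u, 
    Finset.sum_powerset_apply_card (fun k => if k = 0 then 0 else f k), Finset.range_eq_Ico,
    Finset.sum_eq_sum_Ico_succ_bot (Nat.succ_pos _)]
  have h2 : Finset.Ico (0 + 1) (s.card + 1) = Finset.Icc 1 s.card := by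
    ext k
    simp only [Finset.mem_Ico, Finset.mem_Icc]
    omega
  rw [h2, if_pos rfl, smul_zero, zero_add]
  refine Finset.sum_congr rfl fun k hk => ?_
  rw [if_neg (by have := (Finset.mem_Icc.1 hk).1; omega), nsmul_eq_mul]

/-! ### Conditioning on the interferers and inclusion-exclusion -/

namespace RachParams

variable {p : RachParams}

lemma measurable_interference (s : SymbolGroup p.K0) :
    Measurable fun z : Measure (Interferer p.K0) => p.interference z s := by
  have h : ∀ z : Measure (Interferer p.K0), p.interference z s =
      ∫⁻ y, {y : Interferer p.K0 | y.2.1 ≤ ‖y.1‖}.indicator (fun y =>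
        ENNReal.ofReal (p.rho * y.2.1 ^ p.alpha * y.2.2 s * ‖y.1‖ ^ (-p.alpha))) y ∂z := fun z =>
    (lintegral_indicator measurableSet_dist_le_norm _).symm
  simp_rw [h]
  exact Measure.measurable_lintegral
    (Measurable.indicator (by fun_prop) measurableSet_dist_le_norm)

/-- Positive noise keeps the denominator nonzero, and the numerator is finite, so the division can
be cleared even at infinite interference. -/
lemma threshold_le_sinr_iff (hp : p.Admissible) (z : Measure (Interferer p.K0)) (g : ℝ)
    (s : SymbolGroup p.K0) :
    ENNReal.ofReal p.gammaTh ≤ p.sinr z g s ↔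
      ENNReal.ofReal p.gammaTh * (p.interference z s + ENNReal.ofReal p.sigma2) ≤
        ENNReal.ofReal (p.rho * g) := by
  have h : p.interference z s + ENNReal.ofReal p.sigma2 ≠ 0 := by
    simp [hp.sigma2_pos]
  exact ENNReal.le_div_iff_mul_le (.inl h) (.inr ENNReal.ofReal_ne_top)

variable {Ω : Type*} [MeasurableSpace Ω] {Pr : Measure Ω}

lemma measure_forall_threshold_le {ι : Type*} {h : ι → Ω → ℝ} (h_meas : ∀ s, Measurable (h s))
    (h_law : ∀ s, Pr.map (h s) = expMeasure 1) (h_indep : iIndepFun h Pr) {r : ℝ} (hr : 0 < r)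
    (T : Finset ι) (c : ι → ℝ≥0∞) :
    Pr {ω | ∀ s ∈ T, c s ≤ ENNReal.ofReal (r * h s ω)} =
      expNeg (∑ s ∈ T, c s / ENNReal.ofReal r) := by
  have hm : ∀ c : ℝ≥0∞, MeasurableSet {g : ℝ | c ≤ ENNReal.ofReal (r * g)} := fun c =>
    measurableSet_le measurable_const (by fun_prop)
  have h1 : {ω | ∀ s ∈ T, c s ≤ ENNReal.ofReal (r * h s ω)} =
      ⋂ s ∈ T, h s ⁻¹' {g : ℝ | c s ≤ ENNReal.ofReal (r * g)} := by
    ext ω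
    simp
  rw [h1, h_indep.measure_inter_preimage_eq_mul T fun s _ => hm (c s), expNeg_sum]
  refine Finset.prod_congr rfl fun s _ => ?_
  rw [← Measure.map_apply (h_meas s) (hm _), h_law, expMeasure_le_ofReal_mul hr]

variable {Z : Ω → Measure (Interferer p.K0)} {h : ℕ → SymbolGroup p.K0 → Ω → ℝ}

lemma measurableSet_threshold_le_sinr (hp : p.Admissible) (hZ : Measurable Z)
    (h_meas : ∀ m s, Measurable (h m s)) (m : ℕ) (s : SymbolGroup p.K0) :
    MeasurableSet {ω | ENNReal.ofReal p.gammaTh ≤ p.sinr (Z ω) (h m s ω) s} := by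
  simp_rw [threshold_le_sinr_iff hp]
  have h1 : Measurable fun ω => p.interference (Z ω) s := (measurable_interference s).comp hZ
  have h2 := h_meas m s
  exact measurableSet_le (by fun_prop) (by fun_prop)

variable [IsProbabilityMeasure Pr]

/-- Independence makes the joint law of gains and interferers a product; by Tonelli, the gains are
integrated with `z` frozen, where the thresholds are constants. -/
lemma measure_forall_threshold_le_sinr (hp : p.Admissible) (hZ : Measurable Z)
    (h_meas : ∀ m s, Measurable (h m s))
    (h_law : ∀ m s, Pr.map (h m s) = expMeasure 1)
    (h_indep : iIndepFun (fun q : ℕ × SymbolGroup p.K0 => h q.1 q.2) Pr)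
    (h_indep_Z : IndepFun (fun ω (q : ℕ × SymbolGroup p.K0) => h q.1 q.2 ω) Z Pr)
    (m : ℕ) (T : Finset (SymbolGroup p.K0)) :
    Pr {ω | ∀ s ∈ T, ENNReal.ofReal p.gammaTh ≤ p.sinr (Z ω) (h m s ω) s} =
      ENNReal.ofReal (Real.exp (-(T.card * (p.gammaTh * p.sigma2 / p.rho)))) *
        ∫⁻ ω, expNeg (∫⁻ y, p.thresholdLoad T y ∂Z ω) ∂Pr := by
  have hγ := hp.gammaTh_pos
  have hρ := hp.rho_pos
  have hσ := hp.sigma2_pos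
  set H : Ω → (ℕ × SymbolGroup p.K0 → ℝ) := fun ω q => h q.1 q.2 ω with hH
  have hHm : Measurable H := measurable_pi_lambda _ fun q => h_meas q.1 q.2
  set D : Set ((ℕ × SymbolGroup p.K0 → ℝ) × Measure (Interferer p.K0)) :=
    {q | ∀ s ∈ T, ENNReal.ofReal p.gammaTh * (p.interference q.2 s + ENNReal.ofReal p.sigma2) ≤
      ENNReal.ofReal (p.rho * q.1 (m, s))} with hD
  have hDm : MeasurableSet D := by
    have h1 : D = ⋂ s ∈ T, {q | ENNReal.ofReal p.gammaTh *
        (p.interference q.2 s + ENNReal.ofReal p.sigma2) ≤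
          ENNReal.ofReal (p.rho * q.1 (m, s))} := by
      ext q
      simp [hD]
    rw [h1]
    refine Finset.measurableSet_biInter T fun s _ => ?_
    have h2 : Measurable fun q : (ℕ × SymbolGroup p.K0 → ℝ) × Measure (Interferer p.K0) =>
        p.interference q.2 s := (measurable_interference s).comp measurable_snd
    exact measurableSet_le (by fun_prop) (by fun_prop)
  have hset : {ω | ∀ s ∈ T, ENNReal.ofReal p.gammaTh ≤ p.sinr (Z ω) (h m s ω) s} =
      (fun ω => (H ω, Z ω)) ⁻¹' D := by
    ext ω
    exact forall₂_congr fun s _ => threshold_le_sinr_iff hp _ _ _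
  have hcond : ∀ z, Pr.map H ((fun η => (η, z)) ⁻¹' D) =
      ENNReal.ofReal (Real.exp (-(T.card * (p.gammaTh * p.sigma2 / p.rho)))) *
        expNeg (∫⁻ y, p.thresholdLoad T y ∂z) := by
    intro z
    rw [Measure.map_apply hHm (hDm.preimage (by fun_prop))]
    have h1 := measure_forall_threshold_le (fun s => h_meas m s) (fun s => h_law m s)
      (h_indep.precomp (g := fun s => (m, s)) (Prod.mk_right_injective m)) hρ T
      (fun s => ENNReal.ofReal p.gammaTh * (p.interference z s + ENNReal.ofReal p.sigma2))
    have h2 : ∀ s, ENNReal.ofReal p.gammaTh * (p.interference z s + ENNReal.ofReal p.sigma2) /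
        ENNReal.ofReal p.rho = ENNReal.ofReal (p.gammaTh * p.sigma2 / p.rho) +
          ENNReal.ofReal (p.gammaTh / p.rho) * p.interference z s := by
      intro s
      rw [ENNReal.ofReal_div_of_pos hρ, ENNReal.ofReal_div_of_pos hρ, ENNReal.ofReal_mul hγ.le]
      simp only [ENNReal.div_eq_inv_mul]
      ring
    simp_rw [h2, Finset.sum_add_distrib, sum_mul_interference hp] at h1
    rw [expNeg_add, Finset.sum_const, nsmul_eq_mul, ← ENNReal.ofReal_natCast,
      ← ENNReal.ofReal_mul (by positivity), expNeg_ofReal (by positivity)] at h1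
    exact h1
  have hmeas : Measurable fun z => expNeg (∫⁻ y, p.thresholdLoad T y ∂z) :=
    measurable_expNeg.comp (Measure.measurable_lintegral (measurable_thresholdLoad T))
  rw [hset, ← Measure.map_apply (hHm.prodMk hZ) hDm,
    (indepFun_iff_map_prod_eq_prod_map_map hHm.aemeasurable hZ.aemeasurable).1 h_indep_Z,
    Measure.prod_apply_symm hDm]
  simp_rw [hcond]
  rw [lintegral_const_mul _ hmeas, lintegral_map hmeas hZ]

lemma real_biInter_repetitionSuccess (hp : p.Admissible) {ΦB : Ω → Measure Plane}
    (hΦB : IsPoissonProcess ΦB (ENNReal.ofReal p.lamB • (volume : Measure Plane)) Pr)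
    (hZ : IsPoissonProcess Z (p.interfererIntensity ΦB Pr) Pr)
    (h_meas : ∀ m s, Measurable (h m s))
    (h_law : ∀ m s, Pr.map (h m s) = expMeasure 1)
    (h_indep : iIndepFun (fun q : ℕ × SymbolGroup p.K0 => h q.1 q.2) Pr)
    (h_indep_Z : IndepFun (fun ω (q : ℕ × SymbolGroup p.K0) => h q.1 q.2 ω) Z Pr)
    (m : ℕ) (u : Finset (Fin p.K0)) :
    Pr.real (⋂ k ∈ u, p.repetitionSuccess Z h m k) =
      Real.exp (-((4 * u.card : ℕ) : ℝ) * p.gammaTh * p.sigma2 / p.rho -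
        p.laplaceExponent (4 * u.card)) := by
  have hset : (⋂ k ∈ u, p.repetitionSuccess Z h m k) =
      {ω | ∀ s ∈ u ×ˢ (Finset.univ : Finset (Fin 4)),
        ENNReal.ofReal p.gammaTh ≤ p.sinr (Z ω) (h m s ω) s} := by
    ext ω
    simp only [repetitionSuccess, Set.mem_iInter, Finset.mem_product, Finset.mem_univ, and_true,
      Prod.forall]
    exact forall_congr' fun k => forall_comm
  have hcard : (u ×ˢ (Finset.univ : Finset (Fin 4))).card = 4 * u.card := by
    simp [mul_comm]
  rw [hset, measureReal_def, measure_forall_threshold_le_sinr hp hZ.measurable h_meas h_law h_indep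
    h_indep_Z, lintegral_expNeg_lintegral_thresholdLoad hp hΦB hZ, hcard,
    ← ENNReal.ofReal_mul (Real.exp_nonneg _), ENNReal.toReal_ofReal (by positivity),
    ← Real.exp_add]
  congr 1
  ring

/-- Inclusion-exclusion over the repetitions; each term depends only on the number of repetitions
intersected, so subsets are grouped by cardinality. -/
lemma preambleSuccessProb_eq (hp : p.Admissible) {ΦB : Ω → Measure Plane}
    (hΦB : IsPoissonProcess ΦB (ENNReal.ofReal p.lamB • (volume : Measure Plane)) Pr)
    (hZ : IsPoissonProcess Z (p.interfererIntensity ΦB Pr) Pr)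
    (h_meas : ∀ m s, Measurable (h m s))
    (h_law : ∀ m s, Pr.map (h m s) = expMeasure 1)
    (h_indep : iIndepFun (fun q : ℕ × SymbolGroup p.K0 => h q.1 q.2) Pr)
    (h_indep_Z : IndepFun (fun ω (q : ℕ × SymbolGroup p.K0) => h q.1 q.2 ω) Z Pr) (m : ℕ) :
    p.preambleSuccessProb Pr Z h m = p.preambleClosedForm := by
  have hsm : ∀ k, MeasurableSet (p.repetitionSuccess Z h m k) := fun k => by
    have h1 : p.repetitionSuccess Z h m k = ⋂ b : Fin 4,
        {ω | ENNReal.ofReal p.gammaTh ≤ p.sinr (Z ω) (h m (k, b) ω) (k, b)} := by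
      ext ω
      simp [repetitionSuccess]
    rw [h1]
    exact MeasurableSet.iInter fun b =>
      measurableSet_threshold_le_sinr hp hZ.measurable h_meas m (k, b)
  have h1 : (⋃ k, p.repetitionSuccess Z h m k) =
      ⋃ k ∈ (Finset.univ : Finset (Fin p.K0)), p.repetitionSuccess Z h m k := by simp
  rw [preambleSuccessProb, h1, measureReal_biUnion_eq_sum_powerset fun k _ => hsm k]
  simp_rw [real_biInter_repetitionSuccess hp hΦB hZ h_meas h_law h_indep h_indep_Z m]
  rw [sum_powerset_nonempty_apply_card Finset.univ fun k => (-1 : ℝ) ^ (k + 1) *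
    Real.exp (-((4 * k : ℕ) : ℝ) * p.gammaTh * p.sigma2 / p.rho - p.laplaceExponent (4 * k)),
    Finset.card_univ, Fintype.card_fin, preambleClosedForm]
  refine Finset.sum_congr rfl fun k _ => ?_
  rw [laplaceExponent]
  ring

lemma competitorLaw_real_singleton (hp : p.Admissible) (n : ℕ) :
    p.competitorLaw.real {n} = p.pmfClosedForm n := by
  have hc : 0 < cVor := by norm_num [cVor]
  have hl := hp.lamB_pos
  have hΛ := activeDensity_nonneg hp
  have hG : 0 < Gamma (cVor + 1) := Gamma_pos_of_pos (by positivity)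
  have hG' : 0 < Gamma (cVor + 1 + n) := Gamma_pos_of_pos (by positivity)
  rw [measureReal_def, competitorLaw, gammaMeasure_bind_poissonMeasure_singleton (by positivity)
    (by positivity) hΛ, ENNReal.toReal_ofReal (by positivity), pmfClosedForm,
    Gamma_nat_eq_factorial]
  -- Factoring out `lamB` exposes the ratio `Λ/λ_B`; the remaining powers of `lamB` cancel.
  have h1 : cVor * p.lamB + p.activeDensity = p.lamB * (p.activeDensity / p.lamB + cVor) := by
    field_simp
    ring
  have h2 : (n : ℝ) + cVor + 1 = cVor + 1 + n := by ring
  rw [h1, h2, mul_rpow hl.le (by positivity), mul_rpow hc.le hl.le,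
    rpow_add_natCast hl.ne' (cVor + 1) n,
    div_pow]
  field_simp

end RachParams

theorem theorem1 (p : RachParams) (hp : p.Admissible)
    {Ω : Type*} [MeasurableSpace Ω] (Pr : Measure Ω) [IsProbabilityMeasure Pr]
    -- the base stations
    (ΦB : Ω → Measure Plane)
    (hΦB : IsPoissonProcess ΦB (ENNReal.ofReal p.lamB • (volume : Measure Plane)) Pr)
    -- the interfering devices with their marks
    (Z : Ω → Measure (Interferer p.K0))
    (hZ : IsPoissonProcess Z (p.interfererIntensity ΦB Pr) Pr)
    -- the fading gains of the typical device `0` and of its competitors `1, 2, ...`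
    (h : ℕ → SymbolGroup p.K0 → Ω → ℝ)
    (h_meas : ∀ m s, Measurable (h m s))
    (h_law : ∀ m s, Pr.map (h m s) = expMeasure 1)
    (h_indep : iIndepFun (fun q : ℕ × SymbolGroup p.K0 => h q.1 q.2) Pr)
    (h_indep_Z : IndepFun (fun ω (q : ℕ × SymbolGroup p.K0) => h q.1 q.2 ω) Z Pr)
    -- the number of intra-group interferers
    (N : Ω → ℕ) (hN_meas : Measurable N) (hN_law : Pr.map N = p.competitorLaw) :
    p.nonEmptyProb = 1 - Real.exp (-(p.muNew : ℝ)) ∧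
    (∀ n : ℕ, Pr.real {ω | N ω = n} = p.pmfClosedForm n) ∧
    (∀ m : ℕ, p.preambleSuccessProb Pr Z h m = p.preambleClosedForm) ∧
    HasSum
      (fun n₀ : ℕ =>
        p.pmfClosedForm n₀ * p.preambleClosedForm * (1 - p.preambleClosedForm) ^ n₀)
      (p.rachSuccessProb Pr Z h N) := by
  have hpmf : ∀ n : ℕ, Pr.real {ω | N ω = n} = p.pmfClosedForm n := fun n => by
    rw [← RachParams.competitorLaw_real_singleton hp n, ← hN_law,
      map_measureReal_apply hN_meas (measurableSet_singleton n)]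
    rfl
  have hpre : ∀ m : ℕ, p.preambleSuccessProb Pr Z h m = p.preambleClosedForm :=
    RachParams.preambleSuccessProb_eq hp hΦB hZ h_meas h_law h_indep h_indep_Z
  refine ⟨p.nonEmptyProb_eq, hpmf, hpre, ?_⟩
  -- The bounds on the alternating sum are read off from its being a probability.
  have h0 : 0 ≤ p.preambleClosedForm := by
    rw [← hpre 0]
    exact measureReal_nonneg
  have h1 : p.preambleClosedForm ≤ 1 := by
    rw [← hpre 0]
    exact measureReal_le_one
  have hsum := hasSum_integral_geometric hN_meas (sub_nonneg.2 h1) (sub_le_self 1 h0)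
    p.preambleClosedForm (Pr := Pr)
  simp_rw [hpmf] at hsum
  simpa [RachParams.rachSuccessProb, hpre] using hsum
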